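/- Let $\mathcal A$ be a finite nonempty alphabet with $q=|\mathcal A|$ letters, let $V=\mathbb C^{\mathcal A}$ with its standard inner product and standard basis $(e_a)_{a\in\mathcal A}$, and let $d=q^{-1/2}\sum_{a\in\mathcal A}e_a$ (the de Bruijn vector). For $k\ge 1$ let $\theta_L,\theta_R:V^{\otimes k}\to V^{\otimes (k-1)}$ be the linear maps $$\theta_L(v_1\otimes\cdots\otimes v_k)=\langle d,v_1\rangle\,v_2\otimes\cdots\otimes v_k,\qquad \theta_R(v_1\otimes\cdots\otimes v_k)=\langle d,v_k\rangle\,v_1\otimes\cdots\otimes v_{k-1},$$ and let both be $0$ on $V^{\otimes 0}=\mathbb C$. Put $X^k=\ker\theta_L\cap\ker\theta_R\subseteq V^{\otimes k}$ and $T(X)=\bigoplus_{k\ge 0}X^k\subseteq T(V)=\bigoplus_{k\ge0}V^{\otimes k}$. Let $(f_a)_{a\in\mathcal A}$ be an orthogonal basis of $V$ one of whose members is a scalar multiple of $d$ (a Fourier basis). A word $a_1\cdots a_k$ in the letters of $\mathcal A$ is identified with the tensor $f_{a_1}\otimes\cdots\otimes f_{a_k}$. A word is called primitive if it is nonempty,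 lies in $T(X)$, and is not the concatenation of two nonempty words lying in $T(X)$. Let $\mathcal P$ be the set of primitive words, regarded as a new alphabet. Then the tensors $p_1\cdots p_m$ (concatenations of primitive words, $m\ge0$, $p_i\in\mathcal P$), indexed by the words over $\mathcal P$, form a basis of $T(X)$. Define linear operations on $T(X)$ on this basis as follows, for $z=p_1\cdots p_m$ and $z'=p'_1\cdots p'_n$: * the shuffle product: $z \sqcup\!\sqcup z'$ is the sum of all interleavings (with multiplicity) of $p_1,\dots,p_m$ with $p'_1,\dots,p'_n$ that preserve both orders; the concatenation product: $z\cdot z'=p_1\cdots p_mp'_1\cdots p'_n$, which is the restriction to $T(X)$ of the product of the tensor algebra $T(V)$; for both, the unit is the empty word; * the deconcatenation coproduct $\Delta_{\cdot}(z)=\sum_{i=0}^m p_1\cdots p_i\otimes p_{i+1}\cdots p_m$ and the deshuffle coproduct $\Delta_{\sqcup\!\sqcup }(z)=\sum_{I\subseteq\{1,\dots,m\}}z_I\otimes z_{\{1,\dots,m\}\setminus I}$, where $z_I$ is the concatenation of the $p_i$, $i\in I$, in increasing order of $i$; for both, the counit is $1$ on the empty word and $0$ on all other words over $\mathcal P$;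 * the antipode $\gamma(z)=(-1)^m p_m\cdots p_1$. Then: 1. $T(X)$ with product $\sqcup\!\sqcup $, coproduct $\Delta_{\cdot}$ and antipode $\gamma$ is a Hopf algebra over $\mathbb C$. 2. $T(X)$ with product $\cdot$ (concatenation), coproduct $\Delta_{\sqcup\!\sqcup }$ and antipode $\gamma$ is a Hopf algebra over $\mathbb C$. 3. Both Hopf algebras are graded by $T(X)=\bigoplus_kX^k$ and connected ($X^0=\mathbb C\cdot$ empty word). 4. They are graded duals of each other: every $X^k$ is finite-dimensional, and the bilinear form $B$ on $T(X)$ for which the words over $\mathcal P$ are orthonormal satisfies $B(X^i,X^j)=0$ for $i\ne j$, is a perfect pairing on each $X^k$, and makes product, unit, coproduct, counit and antipode of each Hopf algebra adjoint to coproduct, counit, product, unit and antipode of the other. -/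

import Mathlib

open scoped TensorProduct DirectSum

noncomputable section

universe u

namespace DeBruijn

/-! ### The tensor spaces of an alphabet and the space `T(X)` -/

section TensorSpaces

variable (A : Type u) [Fintype A]

/-- The Hermitian space `V_A = ℂ^A`, whose standard basis is indexed by the letters of `A`. -/
abbrev V : Type u := EuclideanSpace ℂ A

/-- The de Bruijn vector `q^{-1/2} ∑ₐ a`, where `q = |A|`. -/
def dBvec : V A := WithLp.toLp 2 fun _ => ((1 / Real.sqrt (Fintype.card A) : ℝ) : ℂ)

/-- The linear form `v ↦ ⟨dBvec, v⟩` on `V_A`; it takes the value `1/√q` on every letter. -/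
def letterForm : V A →ₗ[ℂ] ℂ := innerₛₗ ℂ (dBvec A)

/-- The left deletion operator
`v₁ ⊗ v₂ ⊗ ⋯ ⊗ vₖ ↦ ⟨dBvec, v₁⟩ v₂ ⊗ ⋯ ⊗ vₖ`; it is `0` on tensors of order `0`. -/
def thetaL : (k : ℕ) → (⨂[ℂ]^k (V A)) →ₗ[ℂ] (⨂[ℂ]^(k - 1) (V A))
  | 0 => 0
  | k + 1 => PiTensorProduct.lift (LinearMap.uncurryLeft
      ((letterForm A).smulRight (PiTensorProduct.tprod ℂ (s := fun _ : Fin k => V A))))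

/-- The right deletion operator
`v₁ ⊗ ⋯ ⊗ vₖ₋₁ ⊗ vₖ ↦ ⟨dBvec, vₖ⟩ v₁ ⊗ ⋯ ⊗ vₖ₋₁`; it is `0` on tensors of order `0`. -/
def thetaR : (k : ℕ) → (⨂[ℂ]^k (V A)) →ₗ[ℂ] (⨂[ℂ]^(k - 1) (V A))
  | 0 => 0
  | k + 1 => PiTensorProduct.lift (MultilinearMap.uncurryRight
      ((LinearMap.smulRightₗ (letterForm A)).compMultilinearMap
        (PiTensorProduct.tprod ℂ (s := fun _ : Fin k => V A))))

/-- `X^k = ker θ_L ∩ ker θ_R`, a subspace of `V_A^{⊗ k}`. -/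
def X (k : ℕ) : Submodule ℂ (⨂[ℂ]^k (V A)) :=
  LinearMap.ker (thetaL A k) ⊓ LinearMap.ker (thetaR A k)

/-- The tensor algebra `T(V) = ⨁ₖ V_A^{⊗ k}`; its product is concatenation of tensors. -/
abbrev TV : Type u := ⨁ k : ℕ, ⨂[ℂ]^k (V A)

/-- `T(X) = ⨁ₖ X^k`, as a subspace of `T(V)`: all components have to lie in the `X^k`. -/
def TX : Submodule ℂ (TV A) where
  carrier := {x | ∀ k, x k ∈ X A k}
  add_mem' hx hy k := by
    rw [DirectSum.add_apply]
    exact (X A k).add_mem (hx k) (hy k)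
  zero_mem' k := by
    rw [DirectSum.zero_apply]
    exact (X A k).zero_mem
  smul_mem' c x hx k := by
    rw [DirectSum.smul_apply]
    exact (X A k).smul_mem c (hx k)

/-- The summand `X^k` of `T(X)`: the elements of `T(X)` that are tensors of order `k`. -/
def gradeTX (k : ℕ) : Submodule ℂ (TX A) :=
  (LinearMap.range (DirectSum.lof ℂ ℕ (fun k => ⨂[ℂ]^k (V A)) k)).comap (TX A).subtype

end TensorSpaces

/-! ### Words in Fourier space and primitive words -/

section Words

variable {A : Type u} [Fintype A]

/-- The tensor `f_{a₁} ⊗ ⋯ ⊗ f_{aₖ}` of a word `a₁ ⋯ aₖ`, for a basis `f` of `V_A`. -/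
def wordTensor (f : Module.Basis A ℂ (V A)) (w : List A) : TV A :=
  DirectSum.of (fun k => ⨂[ℂ]^k (V A)) w.length (PiTensorProduct.tprod ℂ fun i => f (w.get i))

/-- A word is primitive if it is a nonempty word in `T(X)` that is not the concatenation of two
nonempty words in `T(X)`. -/
def IsPrimitive (f : Module.Basis A ℂ (V A)) (w : List A) : Prop :=
  w ≠ [] ∧ wordTensor f w ∈ TX A ∧
    ∀ u v : List A, u ≠ [] → v ≠ [] → w = u ++ v →
      ¬ (wordTensor f u ∈ TX A ∧ wordTensor f v ∈ TX A)

/-- The alphabet of primitive words. -/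
abbrev PrimitiveWord (f : Module.Basis A ℂ (V A)) : Type u := {w : List A // IsPrimitive f w}

end Words

/-! ### Hopf algebras, gradings and duality for given operations on a vector space -/

/-- Candidate Hopf algebra operations on a complex vector space. -/
structure HopfOps (M : Type u) [AddCommMonoid M] [Module ℂ M] where
  mul : M →ₗ[ℂ] M →ₗ[ℂ] M
  one : M
  comul : M →ₗ[ℂ] M ⊗[ℂ] M
  counit : M →ₗ[ℂ] ℂ
  antipode : M →ₗ[ℂ] M

section Hopf

variable {M : Type u} [AddCommMonoid M] [Module ℂ M]

/-- The given operations make the vector space a Hopf algebra: together with them, it is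
isomorphic to a Hopf algebra. -/
def HopfOps.IsHopfAlgebra (D : HopfOps M) : Prop :=
  ∃ (H : Type u) (_ : Ring H) (_ : HopfAlgebra ℂ H) (e : M ≃ₗ[ℂ] H),
    (∀ x y, e (D.mul x y) = e x * e y) ∧
    e D.one = 1 ∧
    (∀ x, Coalgebra.comul (R := ℂ) (e x) =
      TensorProduct.map (e : M →ₗ[ℂ] H) (e : M →ₗ[ℂ] H) (D.comul x)) ∧
    (∀ x, Coalgebra.counit (R := ℂ) (e x) = D.counit x) ∧
    (∀ x, HopfAlgebra.antipode ℂ (e x) = e (D.antipode x))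

/-- The operations are graded by `M = ⨁ₖ gr k`, and connected: `gr 0` is spanned by the unit. -/
structure HopfOps.IsGradedConnected (D : HopfOps M) (gr : ℕ → Submodule ℂ M) : Prop where
  isInternal : DirectSum.IsInternal gr
  mul_mem : ∀ i j x y, x ∈ gr i → y ∈ gr j → D.mul x y ∈ gr (i + j)
  gr_zero : gr 0 = ℂ ∙ D.one
  comul_mem : ∀ k x, x ∈ gr k → D.comul x ∈ ⨆ p ∈ Finset.HasAntidiagonal.antidiagonal k,
    LinearMap.range (TensorProduct.map (gr p.1).subtype (gr p.2).subtype)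
  counit_eq_zero : ∀ k x, k ≠ 0 → x ∈ gr k → D.counit x = 0
  antipode_mem : ∀ k x, x ∈ gr k → D.antipode x ∈ gr k

/-- The bilinear form `B` makes `D₁` and `D₂` graded duals of each other: it pairs every
(finite-dimensional) homogeneous component perfectly with itself, different components are
orthogonal, and the operations of each side are adjoint to those of the other. -/
structure AreGradedDual (gr : ℕ → Submodule ℂ M) (B : LinearMap.BilinForm ℂ M)
    (D₁ D₂ : HopfOps M) : Prop where
  finite : ∀ k, Module.Finite ℂ (gr k)
  perfect_left : ∀ k, Function.Bijective (B.domRestrict₁₂ (gr k) (gr k))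
  perfect_right : ∀ k, Function.Bijective (B.domRestrict₁₂ (gr k) (gr k)).flip
  orthogonal : ∀ i j x y, i ≠ j → x ∈ gr i → y ∈ gr j → B x y = 0
  mul_left : ∀ x y z, B (D₁.mul x y) z = (B.tmul B) (x ⊗ₜ[ℂ] y) (D₂.comul z)
  mul_right : ∀ x y z, B x (D₂.mul y z) = (B.tmul B) (D₁.comul x) (y ⊗ₜ[ℂ] z)
  one_left : ∀ z, B D₁.one z = D₂.counit z
  one_right : ∀ x, B x D₂.one = D₁.counit x
  antipode : ∀ x y, B (D₁.antipode x) y = B x (D₂.antipode y)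

end Hopf

/-! ### The two sets of operations on a space with a basis of words -/

section WordOps

/-- All interleavings of two words, with multiplicity. -/
def shuffles {P : Type u} : List P → List P → List (List P)
  | [], v => [v]
  | u, [] => [u]
  | a :: u, c :: v =>
      (shuffles u (c :: v)).map (a :: ·) ++ (shuffles (a :: u) v).map (c :: ·)
  termination_by u v => u.length + v.length

/-- The subword `w_I` of `w` on the positions in `I`, in increasing order. -/
def subword {P : Type u} (w : List P) (I : Finset (Fin w.length)) : List P :=
  ((List.finRange w.length).filter (· ∈ I)).map w.get

variable {P : Type u} {M : Type u} [AddCommMonoid M] [Module ℂ M] (b : Module.Basis (List P) ℂ M)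

/-- The concatenation product, `u · v = uv` on words. -/
def concatMul : M →ₗ[ℂ] M →ₗ[ℂ] M :=
  b.constr ℂ fun u => b.constr ℂ fun v => b (u ++ v)

/-- The shuffle product: the sum over all interleavings of two words. -/
def shuffleMul : M →ₗ[ℂ] M →ₗ[ℂ] M :=
  b.constr ℂ fun u => b.constr ℂ fun v => ((shuffles u v).map b).sum

/-- The deconcatenation coproduct `z₁ ⋯ zₖ ↦ ∑_{i=0}^k z₁ ⋯ zᵢ ⊗ zᵢ₊₁ ⋯ zₖ`. -/
def deconcat : M →ₗ[ℂ] M ⊗[ℂ] M :=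
  b.constr ℂ fun w => ∑ i ∈ Finset.range (w.length + 1), b (w.take i) ⊗ₜ[ℂ] b (w.drop i)

open Classical in
/-- The deshuffle coproduct `z ↦ ∑_I z_I ⊗ z_{Iᶜ}`, over all sets `I` of positions of `z`. -/
def deshuffle : M →ₗ[ℂ] M ⊗[ℂ] M :=
  b.constr ℂ fun w => ∑ I : Finset (Fin w.length), b (subword w I) ⊗ₜ[ℂ] b (subword w Iᶜ)

open Classical in
/-- The counit: `1` on the empty word and `0` on all other words. -/
def wordCounit : M →ₗ[ℂ] ℂ :=
  b.constr ℂ fun w => if w = [] then 1 else 0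

/-- The antipode `z₁ ⋯ zₖ ↦ (-1)^k zₖ ⋯ z₁`. -/
def wordAntipode : M →ₗ[ℂ] M :=
  b.constr ℂ fun w => (-1 : ℂ) ^ w.length • b w.reverse

open Classical in
/-- The bilinear form for which words are orthonormal. -/
def wordPairing : LinearMap.BilinForm ℂ M :=
  b.constr ℂ fun u => b.constr ℂ fun v => if u = v then (1 : ℂ) else 0

/-- Shuffle product with deconcatenation coproduct. -/
def shuffleOps : HopfOps M where
  mul := shuffleMul b
  one := b []
  comul := deconcat b
  counit := wordCounit b
  antipode := wordAntipode b

/-- Concatenation product with deshuffle coproduct. -/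
def concatOps : HopfOps M where
  mul := concatMul b
  one := b []
  comul := deshuffle b
  counit := wordCounit b
  antipode := wordAntipode b

end WordOps

end DeBruijn

end

open scoped TensorProduct DirectSum

/-! Since `f o` is a nonzero multiple of the de Bruijn vector and `f` is orthogonal, the form
`letterForm` vanishes on every `f a` with `a ≠ o` and not on `f o`. On words in the Fourier basis,
`thetaL` and `thetaR` therefore strip an outer letter `o` up to a nonzero scalar and kill every
other nonempty word. Hence T(X) is spanned by the words that neither begin nor end with `o`
(`mem_TX_iff`).

These words form a free monoid: every one factors into indecomposables (`exists_flatten_eq`), and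
uniquely (`flatten_injOn`), because the overlap between two candidates for the first factor would
itself avoid `o` at both ends. So the words over the primitive words index a basis of T(X), which is
a free algebra on them.

What remains holds for any space with a basis of words. Concatenation and deshuffle give the free
algebra with primitive generators; as its coproduct and counit are algebra maps, coassociativity and
the counit laws need checking on letters only (`algHom_ext_letters`). The shuffle operations are the
transposes of these under the word pairing (`wordPairing_shuffleMul`, `wordPairing_concatMul`), and
the Hopf axioms are stable under transposition (`HopfOps.Axioms.dual`), so the shuffle side needs no
direct verification. The grading is by total length of the letters. -/

namespace DeBruijn

universe u v w

/-- The tensor product of bilinear forms. -/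
local infixr:70 " ⊠ " => LinearMap.BilinForm.tmul

/-! ### Adjoint maps for bilinear forms and their tensor products. -/

section Adjoint

variable {M M' N N' L : Type*} [AddCommGroup M] [Module ℂ M] [AddCommGroup M'] [Module ℂ M']
  [AddCommGroup N] [Module ℂ N] [AddCommGroup N'] [Module ℂ N'] [AddCommGroup L] [Module ℂ L]

/-- `f` and `g` are adjoint with respect to the bilinear forms `B` and `C`. -/
def Adj (B : LinearMap.BilinForm ℂ M) (C : LinearMap.BilinForm ℂ N)
    (f : M →ₗ[ℂ] N) (g : N →ₗ[ℂ] M) : Prop :=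
  ∀ x y, C (f x) y = B x (g y)

variable {B : LinearMap.BilinForm ℂ M} {C : LinearMap.BilinForm ℂ N}
  {B' : LinearMap.BilinForm ℂ M'} {C' : LinearMap.BilinForm ℂ N'} {D : LinearMap.BilinForm ℂ L}

theorem Adj.comp {f : M →ₗ[ℂ] N} {g : N →ₗ[ℂ] M} {f' : N →ₗ[ℂ] L} {g' : L →ₗ[ℂ] N}
    (h' : Adj C D f' g') (h : Adj B C f g) : Adj B D (f' ∘ₗ f) (g ∘ₗ g') := fun x y => by
  simp only [LinearMap.comp_apply]
  rw [h', h]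

theorem Adj.id (B : LinearMap.BilinForm ℂ M) : Adj B B LinearMap.id LinearMap.id :=
  fun _ _ => rfl

theorem Adj.map {f : M →ₗ[ℂ] N} {g : N →ₗ[ℂ] M} {f' : M' →ₗ[ℂ] N'} {g' : N' →ₗ[ℂ] M'}
    (h : Adj B C f g) (h' : Adj B' C' f' g') :
    Adj (B ⊠ B') (C ⊠ C') (TensorProduct.map f f') (TensorProduct.map g g') := by
  intro x y
  induction x with
  | zero => simp
  | add x x' hx hx' => simp only [map_add, LinearMap.add_apply, hx, hx']
  | tmul m m' =>
    induction y with
    | zero => simp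
    | add y y' hy hy' => simp only [map_add, hy, hy']
    | tmul n n' => simp [h m n, h' m' n']

theorem Adj.rTensor {f : M →ₗ[ℂ] N} {g : N →ₗ[ℂ] M} (h : Adj B C f g)
    (D : LinearMap.BilinForm ℂ L) :
    Adj (B ⊠ D) (C ⊠ D) (f.rTensor L) (g.rTensor L) :=
  h.map (Adj.id D)

theorem Adj.lTensor {f : M →ₗ[ℂ] N} {g : N →ₗ[ℂ] M} (h : Adj B C f g)
    (D : LinearMap.BilinForm ℂ L) :
    Adj (D ⊠ B) (D ⊠ C) (f.lTensor L) (g.lTensor L) :=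
  (Adj.id D).map h

/-- Lets associators and unitors be transposed: they are isometries, so transposition inverts them.
-/
theorem Adj.symm_of_isometry (e : M ≃ₗ[ℂ] N) (h : ∀ x y, C (e x) (e y) = B x y) :
    Adj B C e e.symm := fun x y => by
  conv_lhs => rw [← e.apply_symm_apply y]
  exact h x (e.symm y)

theorem Adj.isometry_symm (e : M ≃ₗ[ℂ] N) (h : ∀ x y, C (e x) (e y) = B x y) :
    Adj C B e.symm e := fun x y => by
  conv_rhs => rw [← e.apply_symm_apply x]
  exact (h _ _).symm

theorem assoc_isometry (B : LinearMap.BilinForm ℂ M) (C : LinearMap.BilinForm ℂ N)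
    (D : LinearMap.BilinForm ℂ L) (x y) :
    (B ⊠ (C ⊠ D)) (TensorProduct.assoc ℂ M N L x) (TensorProduct.assoc ℂ M N L y) =
      ((B ⊠ C) ⊠ D) x y := by
  have : (B ⊠ (C ⊠ D)).compl₁₂ (TensorProduct.assoc ℂ M N L).toLinearMap
      (TensorProduct.assoc ℂ M N L).toLinearMap = (B ⊠ C) ⊠ D := by
    ext
    simp [mul_assoc, mul_comm]
  exact LinearMap.congr_fun₂ this x y

theorem lid_isometry (B : LinearMap.BilinForm ℂ M) (x y) :
    B (TensorProduct.lid ℂ M x) (TensorProduct.lid ℂ M y) =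
      ((LinearMap.mul ℂ ℂ) ⊠ B) x y := by
  have : B.compl₁₂ (TensorProduct.lid ℂ M).toLinearMap (TensorProduct.lid ℂ M).toLinearMap =
      (LinearMap.mul ℂ ℂ) ⊠ B := by
    ext
    simp
  exact LinearMap.congr_fun₂ this x y

theorem rid_isometry (B : LinearMap.BilinForm ℂ M) (x y) :
    B (TensorProduct.rid ℂ M x) (TensorProduct.rid ℂ M y) =
      (B ⊠ (LinearMap.mul ℂ ℂ)) x y := by
  have : B.compl₁₂ (TensorProduct.rid ℂ M).toLinearMap (TensorProduct.rid ℂ M).toLinearMap =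
      B ⊠ (LinearMap.mul ℂ ℂ) := by
    ext
    simp
  exact LinearMap.congr_fun₂ this x y

theorem tensorTensorTensorComm_adj (B : LinearMap.BilinForm ℂ M) :
    Adj ((B ⊠ B) ⊠ (B ⊠ B)) ((B ⊠ B) ⊠ (B ⊠ B))
      (TensorProduct.tensorTensorTensorComm ℂ M M M M).toLinearMap
      (TensorProduct.tensorTensorTensorComm ℂ M M M M).toLinearMap := by
  have : ((B ⊠ B) ⊠ (B ⊠ B)).compl₁₂
      (TensorProduct.tensorTensorTensorComm ℂ M M M M).toLinearMap LinearMap.id =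
      ((B ⊠ B) ⊠ (B ⊠ B)).compl₁₂ LinearMap.id
        (TensorProduct.tensorTensorTensorComm ℂ M M M M).toLinearMap := by
    ext
    simp [mul_comm, mul_left_comm]
  exact fun x y => LinearMap.congr_fun₂ this x y

/-- Some basis is orthonormal for the bilinear form `B`. -/
def HasOrthonormalBasis {M : Type w} [AddCommGroup M] [Module ℂ M]
    (B : LinearMap.BilinForm ℂ M) : Prop :=
  ∃ (ι : Type v) (b : Module.Basis ι ℂ M), ∀ i x, B x (b i) = b.repr x i

/-- Pairing with the orthonormal basis reads off coordinates, so a map is determined by its adjoint.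
Nothing is needed of the form on the source. Every transposed identity below is proved this way. -/
theorem HasOrthonormalBasis.eq_of_adj (hC : HasOrthonormalBasis.{v} C) {f f' : M →ₗ[ℂ] N}
    {g g' : N →ₗ[ℂ] M} (h : Adj B C f g) (h' : Adj B C f' g') (hg : g = g') : f = f' := by
  obtain ⟨ι, b, hb⟩ := hC
  ext x
  refine b.ext_elem fun i => ?_
  rw [← hb, ← hb, h, h', hg]

theorem HasOrthonormalBasis.tmul (hB : HasOrthonormalBasis.{v} B)
    (hC : HasOrthonormalBasis.{v} C) : HasOrthonormalBasis.{v} (B ⊠ C) := by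
  obtain ⟨ι, b, hb⟩ := hB
  obtain ⟨κ, c, hc⟩ := hC
  refine ⟨ι × κ, b.tensorProduct c, fun ⟨i, j⟩ x => ?_⟩
  induction x with
  | zero => simp
  | add x y hx hy => simp only [map_add, LinearMap.add_apply, hx, hy, Finsupp.add_apply]
  | tmul m n => simp [hb, hc, mul_comm]

theorem hasOrthonormalBasis_mul :
    HasOrthonormalBasis.{v} (LinearMap.mul ℂ ℂ : LinearMap.BilinForm ℂ ℂ) :=
  ⟨PUnit, Module.Basis.singleton PUnit ℂ, fun i x => by simp⟩

end Adjoint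

/-! ### Hopf axioms as identities of linear maps, and their self-duality. -/

section Axioms

variable {M : Type u} [AddCommGroup M] [Module ℂ M]

/-- The product as a linear map on the tensor square. -/
def HopfOps.mulMap (D : HopfOps M) : M ⊗[ℂ] M →ₗ[ℂ] M := TensorProduct.lift D.mul

/-- The unit as a linear map on the scalars. -/
def HopfOps.unitMap (D : HopfOps M) : ℂ →ₗ[ℂ] M := LinearMap.toSpanSingleton ℂ M D.one

/-- The Hopf algebra axioms, as identities between linear maps. -/
structure HopfOps.Axioms (D : HopfOps M) : Prop where
  mul_assoc : D.mulMap ∘ₗ D.mulMap.rTensor M =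
    D.mulMap ∘ₗ D.mulMap.lTensor M ∘ₗ (TensorProduct.assoc ℂ M M M).toLinearMap
  one_mul : D.mulMap ∘ₗ D.unitMap.rTensor M = (TensorProduct.lid ℂ M).toLinearMap
  mul_one : D.mulMap ∘ₗ D.unitMap.lTensor M = (TensorProduct.rid ℂ M).toLinearMap
  coassoc : (TensorProduct.assoc ℂ M M M).toLinearMap ∘ₗ D.comul.rTensor M ∘ₗ D.comul =
    D.comul.lTensor M ∘ₗ D.comul
  counit_comul : D.counit.rTensor M ∘ₗ D.comul = (TensorProduct.lid ℂ M).symm.toLinearMap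
  comul_counit : D.counit.lTensor M ∘ₗ D.comul = (TensorProduct.rid ℂ M).symm.toLinearMap
  comul_mul : D.comul ∘ₗ D.mulMap = TensorProduct.map D.mulMap D.mulMap ∘ₗ
    (TensorProduct.tensorTensorTensorComm ℂ M M M M).toLinearMap ∘ₗ
      TensorProduct.map D.comul D.comul
  comul_one : D.comul ∘ₗ D.unitMap =
    TensorProduct.map D.unitMap D.unitMap ∘ₗ (TensorProduct.lid ℂ ℂ).symm.toLinearMap
  counit_mul : D.counit ∘ₗ D.mulMap =
    (TensorProduct.lid ℂ ℂ).toLinearMap ∘ₗ TensorProduct.map D.counit D.counit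
  counit_one : D.counit ∘ₗ D.unitMap = LinearMap.id
  antipode_left : D.mulMap ∘ₗ D.antipode.rTensor M ∘ₗ D.comul = D.unitMap ∘ₗ D.counit
  antipode_right : D.mulMap ∘ₗ D.antipode.lTensor M ∘ₗ D.comul = D.unitMap ∘ₗ D.counit

/-- Transposition reverses composites, which exchanges associativity with coassociativity, the unit
laws with the counit laws, and `comul_one` with `counit_mul`; `comul_mul`, `counit_one` and the two
antipode laws are each their own transposes. -/
theorem HopfOps.Axioms.dual {B : LinearMap.BilinForm ℂ M} (hB : HasOrthonormalBasis.{u} B)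
    {D E : HopfOps M} (hE : E.Axioms)
    (hmul : Adj (B ⊠ B) B D.mulMap E.comul) (hcomul : Adj B (B ⊠ B) D.comul E.mulMap)
    (hone : Adj (LinearMap.mul ℂ ℂ) B D.unitMap E.counit)
    (hcounit : Adj B (LinearMap.mul ℂ ℂ) D.counit E.unitMap)
    (hant : Adj B B D.antipode E.antipode) : D.Axioms where
  mul_assoc := hB.eq_of_adj (hmul.comp (hmul.rTensor B))
    (hmul.comp ((hmul.lTensor B).comp (Adj.symm_of_isometry _ (assoc_isometry B B B)))) <| by
      rw [LinearMap.comp_assoc, ← hE.coassoc, ← LinearMap.comp_assoc]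
      ext x
      simp
  one_mul := hB.eq_of_adj (hmul.comp (hone.rTensor B))
    (Adj.symm_of_isometry _ (lid_isometry B)) hE.counit_comul
  mul_one := hB.eq_of_adj (hmul.comp (hone.lTensor B))
    (Adj.symm_of_isometry _ (rid_isometry B)) hE.comul_counit
  coassoc := (hB.tmul (hB.tmul hB)).eq_of_adj
    ((Adj.symm_of_isometry _ (assoc_isometry B B B)).comp ((hcomul.rTensor B).comp hcomul))
    ((hcomul.lTensor B).comp hcomul) <| by
      rw [hE.mul_assoc]
      ext x
      simp
  counit_comul := (hasOrthonormalBasis_mul.tmul hB).eq_of_adj ((hcounit.rTensor B).comp hcomul)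
    (Adj.isometry_symm _ (lid_isometry B)) hE.one_mul
  comul_counit := (hB.tmul hasOrthonormalBasis_mul).eq_of_adj ((hcounit.lTensor B).comp hcomul)
    (Adj.isometry_symm _ (rid_isometry B)) hE.mul_one
  comul_mul := (hB.tmul hB).eq_of_adj (hcomul.comp hmul)
    ((hmul.map hmul).comp ((tensorTensorTensorComm_adj B).comp (hcomul.map hcomul)))
    (by rw [hE.comul_mul, LinearMap.comp_assoc])
  comul_one := (hB.tmul hB).eq_of_adj (hcomul.comp hone)
    ((hone.map hone).comp (Adj.isometry_symm _ (lid_isometry _))) hE.counit_mul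
  counit_mul := hasOrthonormalBasis_mul.{u}.eq_of_adj (hcounit.comp hmul)
    ((Adj.symm_of_isometry _ (lid_isometry _)).comp (hcounit.map hcounit)) hE.comul_one
  counit_one := hasOrthonormalBasis_mul.{u}.eq_of_adj (hcounit.comp hone) (Adj.id _) hE.counit_one
  antipode_left := hB.eq_of_adj (hmul.comp ((hant.rTensor B).comp hcomul))
    (hone.comp hcounit) (by rw [LinearMap.comp_assoc, hE.antipode_left])
  antipode_right := hB.eq_of_adj (hmul.comp ((hant.lTensor B).comp hcomul))
    (hone.comp hcounit) (by rw [LinearMap.comp_assoc, hE.antipode_right])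

theorem HopfOps.Axioms.isHopfAlgebra {D : HopfOps M} (h : D.Axioms) : D.IsHopfAlgebra := by
  have hassoc (x y z : M) : D.mul (D.mul x y) z = D.mul x (D.mul y z) := by
    simpa [mulMap] using LinearMap.congr_fun h.mul_assoc ((x ⊗ₜ y) ⊗ₜ z)
  have hone (x : M) : D.mul D.one x = x := by
    simpa [mulMap, unitMap] using LinearMap.congr_fun h.one_mul (1 ⊗ₜ x)
  have hone' (x : M) : D.mul x D.one = x := by
    simpa [mulMap, unitMap] using LinearMap.congr_fun h.mul_one (x ⊗ₜ 1)
  have hc1 : D.counit D.one = 1 := by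
    simpa [unitMap] using LinearMap.congr_fun h.counit_one 1
  have hcm (x y) : D.counit (D.mul x y) = D.counit x * D.counit y := by
    simpa [mulMap] using LinearMap.congr_fun h.counit_mul (x ⊗ₜ y)
  have hd1 : D.comul D.one = D.one ⊗ₜ D.one := by
    simpa [unitMap] using LinearMap.congr_fun h.comul_one 1
  let ring : Ring M :=
    { (inferInstance : AddCommGroup M) with
      mul := fun x y => D.mul x y
      one := D.one
      mul_assoc := hassoc
      one_mul := hone
      mul_one := hone'
      left_distrib := fun x y z => map_add (D.mul x) y z
      right_distrib := fun x y z => LinearMap.map_add₂ D.mul x y z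
      zero_mul := fun x => LinearMap.map_zero₂ D.mul x
      mul_zero := fun x => map_zero (D.mul x) }
  -- Built on the given module structure, so that the identity can serve as the required linear
  -- equivalence.
  let alg : Algebra ℂ M := Algebra.ofModule
    (fun r x y => LinearMap.map_smul₂ D.mul r x y) (fun r x y => map_smul (D.mul x) r y)
  have hmul : LinearMap.mul' ℂ M = D.mulMap := by
    ext x y
    rfl
  have hunit : Algebra.linearMap ℂ M = D.unitMap := by
    ext
    simp [unitMap]
    rfl
  let coalg : Coalgebra ℂ M :=
    { comul := D.comul
      counit := D.counit
      coassoc := h.coassoc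
      rTensor_counit_comp_comul := h.counit_comul
      lTensor_counit_comp_comul := h.comul_counit }
  have hdm (x y : M) : D.comul (x * y) = D.comul x * D.comul y := by
    refine (LinearMap.congr_fun h.comul_mul (x ⊗ₜ y)).trans ?_
    rw [← hmul]
    simp only [LinearMap.comp_apply, TensorProduct.map_tmul]
    generalize D.comul x = s
    generalize D.comul y = t
    induction s with
    | zero => simp
    | add s s' hs hs' => simp only [TensorProduct.add_tmul, map_add, hs, hs', add_mul]
    | tmul a b =>
      induction t with
      | zero => simp
      | add t t' ht ht' => simp only [TensorProduct.tmul_add, map_add, ht, ht', mul_add]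
      | tmul c d => simp
  let bialg : Bialgebra ℂ M := Bialgebra.mk' ℂ M
    hc1
    (hcm _ _)
    hd1
    (hdm _ _)
  let hopf : HopfAlgebra ℂ M :=
    { antipode := D.antipode
      mul_antipode_rTensor_comul := by rw [hmul, hunit]; exact h.antipode_left
      mul_antipode_lTensor_comul := by rw [hmul, hunit]; exact h.antipode_right }
  refine ⟨M, ring, hopf, LinearEquiv.refl ℂ M, fun _ _ => rfl, rfl, fun x => ?_,
    fun _ => rfl, fun _ => rfl⟩
  exact (LinearMap.congr_fun TensorProduct.map_id (D.comul x)).symm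

end Axioms

/-! ### Complementary subwords and recursion on the first letter. -/

section Subwords

variable {P : Type u}

theorem subword_nil (I : Finset (Fin ([] : List P).length)) : subword [] I = [] := rfl

theorem subword_cons (a : P) (w : List P) (I : Finset (Fin (a :: w).length)) :
    subword (a :: w) I = (if 0 ∈ I then [a] else []) ++
      subword w (Finset.univ.filter fun i : Fin w.length => i.succ ∈ I) := by
  simp only [subword, List.length_cons, List.finRange_succ, List.filter_cons, List.filter_map]
  by_cases h : 0 ∈ I
  · simp [h, Function.comp_def]
  · simp [h, Function.comp_def]

theorem sum_finset_fin_succ {N : Type*} [AddCommMonoid N] {n : ℕ}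
    (G : Finset (Fin (n + 1)) → N) :
    ∑ I, G I = ∑ J : Finset (Fin n),
      (G (insert 0 (J.map (Fin.succEmb n))) + G (J.map (Fin.succEmb n))) := by
  have huniv : (Finset.univ : Finset (Fin (n + 1))) =
      insert 0 ((Finset.univ : Finset (Fin n)).map (Fin.succEmb n)) := by
    ext i
    refine Fin.cases ?_ (fun i => ?_) i <;> simp
  have hpow : ((Finset.univ : Finset (Fin n)).map (Fin.succEmb n)).powerset =
      Finset.univ.map (Finset.mapEmbedding (Fin.succEmb n)).toEmbedding := by
    ext J
    simp [Finset.subset_map_iff, eq_comm]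
  rw [← Finset.powerset_univ, huniv, Finset.sum_powerset_insert (by simp), hpow, Finset.sum_map,
    Finset.sum_map, add_comm, ← Finset.sum_add_distrib]
  rfl

/-- The first letter goes to one side or the other of the splitting. This recursion yields both the
multiplicativity of deshuffle and the count of shuffles. -/
theorem sum_subword_cons {N : Type*} [AddCommMonoid N] (F : List P → List P → N) (a : P)
    (w : List P) :
    ∑ I : Finset (Fin (a :: w).length), F (subword (a :: w) I) (subword (a :: w) Iᶜ) =
      ∑ I : Finset (Fin w.length), (F (a :: subword w I) (subword w Iᶜ) +
        F (subword w I) (a :: subword w Iᶜ)) := by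
  refine (sum_finset_fin_succ (n := w.length)
    fun I => F (subword (a :: w) I) (subword (a :: w) Iᶜ)).trans
    (Finset.sum_congr rfl fun J _ => ?_)
  have h1 : subword (a :: w) (insert 0 (J.map (Fin.succEmb w.length))) = a :: subword w J := by
    rw [subword_cons, if_pos (Finset.mem_insert_self _ _)]
    exact congrArg (fun I => a :: subword w I) (Finset.ext fun i => by simp)
  have h2 : subword (a :: w) (insert 0 (J.map (Fin.succEmb w.length)))ᶜ = subword w Jᶜ := by
    rw [subword_cons, if_neg (by simp)]
    exact congrArg (subword w) (Finset.ext fun i => by simp)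
  have h3 : subword (a :: w) (J.map (Fin.succEmb w.length)) = subword w J := by
    rw [subword_cons, if_neg (by simp)]
    exact congrArg (subword w) (Finset.ext fun i => by simp)
  have h4 : subword (a :: w) (J.map (Fin.succEmb w.length))ᶜ = a :: subword w Jᶜ := by
    rw [subword_cons, if_pos (by simp)]
    exact congrArg (fun I => a :: subword w I) (Finset.ext fun i => by simp)
  rw [← h1, ← h4, ← h2, ← h3]

end Subwords

/-! ### The concatenation Hopf algebra, over an algebra with a multiplicative basis of words. -/

section ConcatHopf

variable {P : Type u} {H : Type u} [Ring H] [Algebra ℂ H] (b : Module.Basis (List P) ℂ H)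

theorem wordCounit_basis {M : Type u} [AddCommGroup M] [Module ℂ M]
    (b : Module.Basis (List P) ℂ M) [DecidableEq (List P)] (w : List P) :
    wordCounit b (b w) = if w = [] then 1 else 0 := by
  simp only [wordCounit, Module.Basis.constr_basis]
  congr

theorem deshuffle_nil {M : Type u} [AddCommGroup M] [Module ℂ M]
    (b : Module.Basis (List P) ℂ M) : deshuffle b (b []) = b [] ⊗ₜ b [] := by
  simp [deshuffle, Module.Basis.constr_basis, subword_nil]

theorem wordAntipode_basis {M : Type u} [AddCommGroup M] [Module ℂ M]
    (b : Module.Basis (List P) ℂ M) (w : List P) :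
    wordAntipode b (b w) = (-1 : ℂ) ^ w.length • b w.reverse := by
  simp [wordAntipode, Module.Basis.constr_basis]

theorem concatMul_basis {M : Type u} [AddCommMonoid M] [Module ℂ M]
    (b : Module.Basis (List P) ℂ M) (u w : List P) :
    concatMul b (b u) (b w) = b (u ++ w) := by
  simp [concatMul, Module.Basis.constr_basis]

variable (h1 : b [] = 1) (hm : ∀ u w, b (u ++ w) = b u * b w)
include h1 hm

omit h1 in
-- Choosing a side for the first letter is multiplication by its primitive coproduct;
-- `deshuffle_mul` follows by induction on the left word.
theorem deshuffle_cons (a : P) (w : List P) :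
    deshuffle b (b (a :: w)) = (b [a] ⊗ₜ[ℂ] 1 + 1 ⊗ₜ[ℂ] b [a]) * deshuffle b (b w) := by
  have hc : ∀ u, b (a :: u) = b [a] * b u := fun u => hm [a] u
  simp only [deshuffle, Module.Basis.constr_basis]
  rw [sum_subword_cons fun u v => b u ⊗ₜ[ℂ] b v, Finset.mul_sum]
  exact Finset.sum_congr rfl fun I _ => by
    rw [hc (subword w I), hc (subword w Iᶜ)]
    simp [add_mul]

theorem deshuffle_letter (a : P) :
    deshuffle b (b [a]) = b [a] ⊗ₜ[ℂ] 1 + 1 ⊗ₜ[ℂ] b [a] := by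
  rw [deshuffle_cons b hm, deshuffle_nil, h1, ← Algebra.TensorProduct.one_def, mul_one]

theorem deshuffle_mul (x y : H) : deshuffle b (x * y) = deshuffle b x * deshuffle b y := by
  have key : ∀ u w, deshuffle b (b u * b w) = deshuffle b (b u) * deshuffle b (b w) := by
    intro u w
    induction u with
    | nil => rw [deshuffle_nil, h1, one_mul, ← Algebra.TensorProduct.one_def, one_mul]
    | cons a u ih =>
      rw [← hm, List.cons_append, deshuffle_cons b hm, hm, ih, ← mul_assoc,
        ← deshuffle_cons b hm]
  have : (LinearMap.mul ℂ H).compr₂ (deshuffle b) =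
      (LinearMap.mul ℂ (H ⊗[ℂ] H)).compl₁₂ (deshuffle b) (deshuffle b) :=
    b.ext fun u => b.ext fun w => key u w
  exact LinearMap.congr_fun₂ this x y

omit h1 in
theorem wordCounit_mul (x y : H) : wordCounit b (x * y) = wordCounit b x * wordCounit b y := by
  classical
  have : (LinearMap.mul ℂ H).compr₂ (wordCounit b) =
      (LinearMap.mul ℂ ℂ).compl₁₂ (wordCounit b) (wordCounit b) :=
    b.ext fun u => b.ext fun w => by
      by_cases hu : u = [] <;> simp [← hm, wordCounit_basis, hu]
  exact LinearMap.congr_fun₂ this x y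

omit h1 in
theorem wordAntipode_mul (x y : H) :
    wordAntipode b (x * y) = wordAntipode b y * wordAntipode b x := by
  have : (LinearMap.mul ℂ H).compr₂ (wordAntipode b) =
      ((LinearMap.mul ℂ H).compl₁₂ (wordAntipode b) (wordAntipode b)).flip :=
    b.ext fun u => b.ext fun w => by
      simp [← hm, wordAntipode_basis, pow_add, mul_smul]
  exact LinearMap.congr_fun₂ this x y

/-- The deshuffle coproduct as an algebra homomorphism. -/
noncomputable def deshuffleAlgHom : H →ₐ[ℂ] H ⊗[ℂ] H :=
  AlgHom.ofLinearMap (deshuffle b)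
    (by rw [← h1, deshuffle_nil, h1, Algebra.TensorProduct.one_def])
    (deshuffle_mul b h1 hm)

/-- The counit as an algebra homomorphism. -/
noncomputable def wordCounitAlgHom : H →ₐ[ℂ] ℂ :=
  AlgHom.ofLinearMap (wordCounit b) (by classical rw [← h1, wordCounit_basis, if_pos rfl])
    (wordCounit_mul b hm)

/-- The letters generate `H`, each word being the product of its letters. -/
theorem algHom_ext_letters {C : Type*} [Ring C] [Algebra ℂ C] {φ ψ : H →ₐ[ℂ] C}
    (h : ∀ a, φ (b [a]) = ψ (b [a])) : φ = ψ := by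
  have : φ.toLinearMap = ψ.toLinearMap := b.ext fun w => by
    induction w with
    | nil => simp [h1]
    | cons a w ih =>
      have hc : b (a :: w) = b [a] * b w := hm [a] w
      rw [AlgHom.toLinearMap_apply, AlgHom.toLinearMap_apply] at ih ⊢
      rw [hc, map_mul, map_mul, h, ih]
  exact AlgHom.toLinearMap_injective this

theorem concat_coassoc :
    (Algebra.TensorProduct.assoc ℂ ℂ ℂ H H H).toAlgHom.comp
      ((Algebra.TensorProduct.map (deshuffleAlgHom b h1 hm) (.id ℂ H)).comp
        (deshuffleAlgHom b h1 hm)) =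
      (Algebra.TensorProduct.map (.id ℂ H) (deshuffleAlgHom b h1 hm)).comp
        (deshuffleAlgHom b h1 hm) := by
  refine algHom_ext_letters b h1 hm fun a => ?_
  have h : deshuffleAlgHom b h1 hm (b [a]) = b [a] ⊗ₜ[ℂ] 1 + 1 ⊗ₜ[ℂ] b [a] :=
    deshuffle_letter b h1 hm a
  simp [h, TensorProduct.add_tmul, TensorProduct.tmul_add, Algebra.TensorProduct.one_def, add_assoc]

theorem concat_antipode_left (x : H) :
    LinearMap.mul' ℂ H ((wordAntipode b).rTensor H (deshuffle b x)) =
      wordCounit b x • (1 : H) := by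
  classical
  have : LinearMap.mul' ℂ H ∘ₗ (wordAntipode b).rTensor H ∘ₗ deshuffle b =
      (wordCounit b).smulRight (1 : H) := b.ext fun w => by
    cases w with
    | nil =>
      simp only [LinearMap.comp_apply, deshuffle_nil, LinearMap.smulRight_apply, wordCounit_basis,
        LinearMap.rTensor_tmul, wordAntipode_basis]
      simp [h1]
    | cons a w =>
      simp only [LinearMap.comp_apply, deshuffle_cons b hm, LinearMap.smulRight_apply,
        wordCounit_basis, if_neg (List.cons_ne_nil a w), zero_smul]
      -- The cancellation holds for any tensor in place of the coproduct of `w`: writing S for the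
      -- antipode, S(ax)y + S(x)ay = -S(x)ay + S(x)ay = 0.
      induction deshuffle b (b w) with
      | zero => simp
      | add x y hx hy => simp only [mul_add, map_add, hx, hy, add_zero]
      | tmul x y =>
        simp [add_mul, wordAntipode_mul b hm, wordAntipode_basis, mul_assoc]
  exact LinearMap.congr_fun this x

theorem concat_antipode_right (x : H) :
    LinearMap.mul' ℂ H ((wordAntipode b).lTensor H (deshuffle b x)) =
      wordCounit b x • (1 : H) := by
  classical
  have : LinearMap.mul' ℂ H ∘ₗ (wordAntipode b).lTensor H ∘ₗ deshuffle b =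
      (wordCounit b).smulRight (1 : H) := b.ext fun w => by
    -- Here the last letter must be split off: xaS(y) + xS(ya) cancels termwise, whereas axS(y) +
    -- xS(ay) does not.
    induction w using List.reverseRecOn with
    | nil =>
      simp only [LinearMap.comp_apply, deshuffle_nil, LinearMap.smulRight_apply, wordCounit_basis,
        LinearMap.lTensor_tmul, wordAntipode_basis]
      simp [h1]
    | append_singleton w a _ =>
      simp only [LinearMap.comp_apply, hm, deshuffle_mul b h1 hm, deshuffle_letter b h1 hm,
        LinearMap.smulRight_apply, wordCounit_mul b hm, wordCounit_basis,
        if_neg (List.cons_ne_nil a []), mul_zero, zero_smul]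
      induction deshuffle b (b w) with
      | zero => simp
      | add x y hx hy => simp only [add_mul, map_add, hx, hy, add_zero]
      | tmul x y =>
        simp [mul_add, wordAntipode_mul b hm, wordAntipode_basis, mul_assoc]
  exact LinearMap.congr_fun this x

omit h1 in
theorem concatMul_eq_mul : concatMul b = LinearMap.mul ℂ H :=
  b.ext fun u => b.ext fun w => by rw [concatMul_basis, hm]; rfl

theorem concatOps_axioms_of_algebra : (concatOps b).Axioms := by
  have hμ : (concatOps b).mulMap = LinearMap.mul' ℂ H := by
    simp only [HopfOps.mulMap, concatOps, concatMul_eq_mul b hm]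
    rfl
  have hu : (concatOps b).unitMap = LinearMap.toSpanSingleton ℂ H 1 := by
    rw [HopfOps.unitMap, concatOps, h1]
  have hΔ : (concatOps b).comul = (deshuffleAlgHom b h1 hm).toLinearMap := rfl
  have hε : (concatOps b).counit = (wordCounitAlgHom b h1 hm).toLinearMap := rfl
  have hl : ∀ a, deshuffleAlgHom b h1 hm (b [a]) = b [a] ⊗ₜ[ℂ] 1 + 1 ⊗ₜ[ℂ] b [a] :=
    deshuffle_letter b h1 hm
  have hεl : ∀ a, wordCounitAlgHom b h1 hm (b [a]) = 0 := fun a => by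
    classical exact (wordCounit_basis b [a]).trans (if_neg (List.cons_ne_nil a []))
  refine ⟨?_, ?_, ?_, ?_, ?_, ?_, ?_, ?_, ?_, ?_, ?_, ?_⟩
  · rw [hμ]
    ext x y z
    simp [mul_assoc]
  · rw [hμ, hu]
    ext x
    simp
  · rw [hμ, hu]
    ext x
    simp
  · exact congrArg AlgHom.toLinearMap (concat_coassoc b h1 hm)
  · have : (Algebra.TensorProduct.map (wordCounitAlgHom b h1 hm) (.id ℂ H)).comp
        (deshuffleAlgHom b h1 hm) = (Algebra.TensorProduct.lid ℂ H).symm.toAlgHom :=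
      algHom_ext_letters b h1 hm fun a => by simp [hl, hεl]
    exact congrArg AlgHom.toLinearMap this
  · have : (Algebra.TensorProduct.map (.id ℂ H) (wordCounitAlgHom b h1 hm)).comp
        (deshuffleAlgHom b h1 hm) = (Algebra.TensorProduct.rid ℂ ℂ H).symm.toAlgHom :=
      algHom_ext_letters b h1 hm fun a => by simp [hl, hεl]
    exact congrArg AlgHom.toLinearMap this
  · rw [hμ, hΔ]
    ext x y
    simp only [TensorProduct.AlgebraTensorModule.curry_apply, LinearMap.restrictScalars_self,
      TensorProduct.curry_apply, LinearMap.comp_apply, LinearMap.mul'_apply,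
      AlgHom.toLinearMap_apply, map_mul, TensorProduct.map_tmul, LinearEquiv.coe_coe]
    generalize deshuffleAlgHom b h1 hm x = s
    generalize deshuffleAlgHom b h1 hm y = t
    induction s with
    | zero => simp
    | add s s' hs hs' => simp only [TensorProduct.add_tmul, map_add, hs, hs', add_mul]
    | tmul a b =>
      induction t with
      | zero => simp
      | add t t' ht ht' => simp only [TensorProduct.tmul_add, map_add, ht, ht', mul_add]
      | tmul c d => simp
  · rw [hu, hΔ]
    ext
    simp [Algebra.TensorProduct.one_def]
  · rw [hμ, hε]
    ext x y
    simp
  · rw [hu, hε]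
    ext
    simp
  · rw [hμ, hu]
    ext x
    exact (concat_antipode_left b h1 hm x).trans (by simp [concatOps])
  · rw [hμ, hu]
    ext x
    exact (concat_antipode_right b h1 hm x).trans (by simp [concatOps])

end ConcatHopf

/-! ### The concatenation Hopf algebra on an arbitrary space with a basis of words. -/

section WordHopf

variable {P : Type u} {M : Type u} [AddCommGroup M] [Module ℂ M] (b : Module.Basis (List P) ℂ M)

theorem concatOps_axioms : (concatOps b).Axioms := by
  have hassoc (x y z : M) :
      concatMul b (concatMul b x y) z = concatMul b x (concatMul b y z) := by
    have : TensorProduct.lift (concatMul b) ∘ₗ (TensorProduct.lift (concatMul b)).rTensor M =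
        TensorProduct.lift (concatMul b) ∘ₗ (TensorProduct.lift (concatMul b)).lTensor M ∘ₗ
          (TensorProduct.assoc ℂ M M M).toLinearMap :=
      ((b.tensorProduct b).tensorProduct b).ext fun ⟨⟨u, v⟩, w⟩ => by simp [concatMul_basis]
    simpa using LinearMap.congr_fun this ((x ⊗ₜ y) ⊗ₜ z)
  have hone (x : M) : concatMul b (b []) x = x :=
    LinearMap.congr_fun (b.ext fun w => by simp [concatMul_basis] :
      concatMul b (b []) = LinearMap.id) x
  have hone' (x : M) : concatMul b x (b []) = x :=
    LinearMap.congr_fun (b.ext fun w => by simp [concatMul_basis] :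
      (concatMul b).flip (b []) = LinearMap.id) x
  -- With concatenation installed as the ring product, the basis is multiplicative by construction.
  let ring : Ring M :=
    { (inferInstance : AddCommGroup M) with
      mul := fun x y => concatMul b x y
      one := b []
      mul_assoc := hassoc
      one_mul := hone
      mul_one := hone'
      left_distrib := fun x y z => map_add (concatMul b x) y z
      right_distrib := fun x y z => LinearMap.map_add₂ (concatMul b) x y z
      zero_mul := fun x => LinearMap.map_zero₂ (concatMul b) x
      mul_zero := fun x => map_zero (concatMul b x) }
  let alg : Algebra ℂ M := Algebra.ofModule
    (fun r x y => LinearMap.map_smul₂ (concatMul b) r x y)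
    (fun r x y => map_smul (concatMul b x) r y)
  exact concatOps_axioms_of_algebra (H := M) b rfl fun u w => (concatMul_basis b u w).symm

end WordHopf

/-! ### The word pairing and the shuffle Hopf algebra by duality. -/

section Pairing

variable {P : Type u} {M : Type u} [AddCommGroup M] [Module ℂ M] (b : Module.Basis (List P) ℂ M)

theorem wordPairing_basis [DecidableEq (List P)] (u w : List P) :
    wordPairing b (b u) (b w) = if u = w then 1 else 0 := by
  simp only [wordPairing, Module.Basis.constr_basis]
  congr

theorem wordPairing_basis_right (x : M) (w : List P) :
    wordPairing b x (b w) = b.repr x w := by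
  classical
  have : (wordPairing b).flip (b w) = b.coord w := b.ext fun u => by
    simp [wordPairing_basis, Finsupp.single_apply]
  exact LinearMap.congr_fun this x

theorem wordPairing_comm (x y : M) : wordPairing b x y = wordPairing b y x := by
  classical
  have : (wordPairing b).flip = wordPairing b := b.ext fun u => b.ext fun w => by
    simp [wordPairing_basis, eq_comm]
  exact LinearMap.congr_fun₂ this y x

theorem shuffles_nil_left (w : List P) : shuffles [] w = [w] := by
  simp [shuffles]

theorem shuffles_nil_right (u : List P) : shuffles u [] = [u] := by
  cases u <;> simp [shuffles]

theorem shuffles_cons_cons (a c : P) (u v : List P) :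
    shuffles (a :: u) (c :: v) =
      (shuffles u (c :: v)).map (a :: ·) ++ (shuffles (a :: u) v).map (c :: ·) := by
  rw [shuffles]

open Classical in
/-- The number of interleavings of `u` and `v` equal to `w` is the number of ways to split `w`
into the complementary subwords `u` and `v`. -/
theorem count_shuffles (u v w : List P) :
    (shuffles u v).count w = ∑ I : Finset (Fin w.length),
      if u = subword w I ∧ v = subword w Iᶜ then 1 else 0 := by
  induction w generalizing u v with
  | nil =>
    simp only [subword_nil]
    cases u with
    | nil => cases v <;> simp [shuffles_nil_left]
    | cons a u => cases v <;> simp [shuffles_nil_right, shuffles_cons_cons, List.count_eq_zero]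
  | cons d w ih =>
    rw [sum_subword_cons fun x y => if u = x ∧ v = y then 1 else 0, Finset.sum_add_distrib]
    have hinj : ∀ (a : P) (l : List (List P)),
        (l.map (a :: ·)).count (d :: w) = if a = d then l.count w else 0 := by
      intro a l
      split_ifs with h
      · subst h
        exact List.count_map_of_injective l _ (List.cons_injective) w
      · simp [List.count_eq_zero, h]
    cases u with
    | nil =>
      cases v with
      | nil => simp [shuffles_nil_left]
      | cons c v =>
        -- Puts the degenerate case in the same recursive form as the general one, so that `hinj`
        -- and the induction hypothesis apply.
        have h : shuffles [] (c :: v) = (shuffles [] v).map (c :: ·) := by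
          simp [shuffles_nil_left]
        rw [h, hinj, ih]
        split_ifs with h <;> simp [h]
    | cons a u =>
      cases v with
      | nil =>
        have h : shuffles (a :: u) [] = (shuffles u []).map (a :: ·) := by
          simp [shuffles_nil_right]
        rw [h, hinj, ih]
        split_ifs with h <;> simp [h]
      | cons c v =>
        rw [shuffles_cons_cons, List.count_append, hinj, hinj, ih, ih]
        congr 1
        · split_ifs with h <;> simp [h]
        · split_ifs with h <;> simp [h]

theorem shuffleMul_basis (u w : List P) :
    shuffleMul b (b u) (b w) = ((shuffles u w).map b).sum := by
  simp [shuffleMul, Module.Basis.constr_basis]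

/-- On words, both sides count the same thing: the left the interleavings equal to a given word, the
right its splittings into the two given subwords (`count_shuffles`). -/
theorem wordPairing_shuffleMul (x y z : M) : wordPairing b (shuffleMul b x y) z =
    ((wordPairing b).tmul (wordPairing b)) (x ⊗ₜ[ℂ] y) (deshuffle b z) := by
  classical
  have key : ∀ u v w, wordPairing b (shuffleMul b (b u) (b v)) (b w) =
      ((wordPairing b).tmul (wordPairing b)) (b u ⊗ₜ[ℂ] b v) (deshuffle b (b w)) := by
    intro u v w
    have h1 : ∀ l : List (List P), wordPairing b (l.map b).sum (b w) = l.count w := by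
      intro l
      induction l with
      | nil => simp
      | cons x l ih => simp [ih, wordPairing_basis, List.count_cons, add_comm]
    rw [shuffleMul_basis, h1, count_shuffles]
    simp [deshuffle, Module.Basis.constr_basis, wordPairing_basis, ite_and]
  have h : wordPairing b ∘ₗ TensorProduct.lift (shuffleMul b) =
    (LinearMap.BilinForm.tmul (wordPairing b) (wordPairing b)).compl₁₂ LinearMap.id (deshuffle b) :=
    (b.tensorProduct b).ext fun ⟨u, v⟩ => b.ext fun w => by simpa using key u v w
  exact LinearMap.congr_fun₂ h (x ⊗ₜ y) z

theorem wordPairing_concatMul (x y z : M) : wordPairing b x (concatMul b y z) =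
    ((wordPairing b).tmul (wordPairing b)) (deconcat b x) (y ⊗ₜ[ℂ] z) := by
  classical
  have key : ∀ u v w, wordPairing b (b w) (concatMul b (b u) (b v)) =
      ((wordPairing b).tmul (wordPairing b)) (deconcat b (b w)) (b u ⊗ₜ[ℂ] b v) := by
    intro u v w
    simp only [concatMul_basis, deconcat, Module.Basis.constr_basis, map_sum, LinearMap.sum_apply,
      LinearMap.BilinForm.tensorDistrib_tmul, wordPairing_basis]
    by_cases h : w = u ++ v
    · subst h
      -- Only the cut at the length of `u` contributes: for any other admissible cut the prefix has
      -- the wrong length.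
      rw [if_pos rfl, Finset.sum_eq_single u.length]
      · simp
      · intro i hi hne
        have : (u ++ v).take i ≠ u := fun e => hne (by
          have := congrArg List.length e
          rw [List.length_take] at this
          have := Finset.mem_range.1 hi
          omega)
        simp [this]
      · simp
    · rw [if_neg h, Finset.sum_eq_zero]
      intro i _
      by_cases hu : w.take i = u
      · have hv : w.drop i ≠ v := fun e => h (by rw [← hu, ← e, List.take_append_drop])
        simp [hv]
      · simp [hu]
  have h : (wordPairing b).compl₂ (TensorProduct.lift (concatMul b)) =
      LinearMap.BilinForm.tmul (wordPairing b) (wordPairing b) ∘ₗ deconcat b :=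
    b.ext fun w => (b.tensorProduct b).ext fun ⟨u, v⟩ => by simpa using key u v w
  exact LinearMap.congr_fun₂ h x (y ⊗ₜ z)

theorem wordPairing_antipode (x y : M) :
    wordPairing b (wordAntipode b x) y = wordPairing b x (wordAntipode b y) := by
  classical
  have : (wordPairing b) ∘ₗ wordAntipode b = (wordPairing b).compl₂ (wordAntipode b) :=
    b.ext fun u => b.ext fun w => by
      by_cases h : u.reverse = w
      · subst h
        simp [wordPairing_basis, wordAntipode_basis]
      · have h' : u ≠ w.reverse := fun e => h (by simp [e])
        simp [wordPairing_basis, wordAntipode_basis, h, h']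
  exact LinearMap.congr_fun₂ this x y

theorem wordPairing_empty (z : M) : wordPairing b (b []) z = wordCounit b z := by
  classical
  exact LinearMap.congr_fun (b.ext fun w => by
    simp [wordPairing_basis, wordCounit_basis, eq_comm] : wordPairing b (b []) = wordCounit b) z

theorem shuffleOps_axioms : (shuffleOps b).Axioms := by
  refine (concatOps_axioms b).dual ⟨List P, b, fun w x => wordPairing_basis_right b x w⟩
    ?_ ?_ ?_ ?_ (wordPairing_antipode b)
  · intro t z
    induction t with
    | zero => simp
    | add s t hs ht => simp only [map_add, LinearMap.add_apply, hs, ht]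
    | tmul x y => exact wordPairing_shuffleMul b x y z
  · intro x t
    induction t with
    | zero => simp
    | add s t hs ht => simp only [map_add, hs, ht]
    | tmul y z => exact (wordPairing_concatMul b x y z).symm
  · intro c z
    simp [HopfOps.unitMap, shuffleOps, concatOps, wordPairing_empty]
  · intro x c
    simp [HopfOps.unitMap, shuffleOps, concatOps, wordPairing_comm b x, wordPairing_empty, mul_comm]

end Pairing

/-! ### Grading by weight, and perfectness of the pairing in each degree. -/

section Grading

variable {P : Type u} {M : Type u} [AddCommGroup M] [Module ℂ M] (b : Module.Basis (List P) ℂ M)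
  (wt : P → ℕ)

/-- The weight of a word, for given weights of the letters. -/
def weight (w : List P) : ℕ := (w.map wt).sum

theorem weight_append (u w : List P) : weight wt (u ++ w) = weight wt u + weight wt w := by
  simp [weight]

/-- The subspace spanned by the words of weight `k`. -/
def wordGrade (k : ℕ) : Submodule ℂ M := Submodule.span ℂ (b '' {w | weight wt w = k})

theorem basis_mem_wordGrade (w : List P) : b w ∈ wordGrade b wt (weight wt w) :=
  Submodule.subset_span ⟨w, rfl, rfl⟩

theorem basis_mem_wordGrade' {w : List P} {k : ℕ} (h : weight wt w = k) :
    b w ∈ wordGrade b wt k := h ▸ basis_mem_wordGrade b wt w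

theorem mem_wordGrade_iff {k : ℕ} {x : M} :
    x ∈ wordGrade b wt k ↔ ∀ w, b.repr x w ≠ 0 → weight wt w = k := by
  rw [wordGrade, Module.Basis.mem_span_image]
  simp [Set.subset_def]

theorem wordGrade_isInternal : DirectSum.IsInternal (wordGrade b wt) := by
  let D : DirectSum.Decomposition (wordGrade b wt) :=
    DirectSum.Decomposition.ofLinearMap _
      (b.constr ℂ fun w => DirectSum.lof ℂ ℕ (fun k => wordGrade b wt k) (weight wt w)
        ⟨b w, basis_mem_wordGrade b wt w⟩)
      (b.ext fun w => by simp)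
      (by
        refine DirectSum.linearMap_ext ℂ fun k => LinearMap.ext fun ⟨x, hx⟩ => ?_
        simp only [LinearMap.comp_apply, DirectSum.coeLinearMap_lof, LinearMap.id_apply]
        induction hx using Submodule.span_induction with
        | mem x hx =>
          obtain ⟨w, rfl, rfl⟩ := hx
          simp
        | zero => exact (map_zero _).trans (map_zero _).symm
        | add x y hx hy ihx ihy =>
          rw [map_add, ihx, ihy, ← map_add]
          rfl
        | smul c x hx ih =>
          rw [map_smul, ih, ← map_smul]
          rfl)
  exact D.isInternal

theorem map_mem_of_basis {N : Type*} [AddCommGroup N] [Module ℂ N] {k : ℕ} {S : Submodule ℂ N}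
    (φ : M →ₗ[ℂ] N) (h : ∀ w, weight wt w = k → φ (b w) ∈ S) {x : M} (hx : x ∈ wordGrade b wt k) :
    φ x ∈ S := by
  have : wordGrade b wt k ≤ S.comap φ := Submodule.span_le.2 (by
    rintro _ ⟨w, hw, rfl⟩
    exact h w hw)
  exact this hx

theorem weight_eq_zero (hwt : ∀ p, wt p ≠ 0) {w : List P} (h : weight wt w = 0) : w = [] := by
  cases w with
  | nil => rfl
  | cons p w =>
    simp only [weight, List.map_cons, List.sum_cons, Nat.add_eq_zero_iff] at h
    exact absurd h.1 (hwt p)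

theorem wordGrade_zero (hwt : ∀ p, wt p ≠ 0) : wordGrade b wt 0 = ℂ ∙ b [] := by
  rw [wordGrade, ← Set.image_singleton]
  congr 2
  ext w
  exact ⟨weight_eq_zero wt hwt, fun h => by rw [Set.mem_singleton_iff.1 h]; rfl⟩

theorem mul_mem_wordGrade {μ : M →ₗ[ℂ] M →ₗ[ℂ] M}
    (h : ∀ u v, μ (b u) (b v) ∈ wordGrade b wt (weight wt u + weight wt v)) (i j : ℕ) (x y : M)
    (hx : x ∈ wordGrade b wt i) (hy : y ∈ wordGrade b wt j) : μ x y ∈ wordGrade b wt (i + j) := by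
  refine map_mem_of_basis b wt (μ.flip y) (fun u hu => ?_) hx
  refine map_mem_of_basis b wt (μ (b u)) (fun v hv => ?_) hy
  rw [← hu, ← hv]
  exact h u v

theorem tmul_mem_iSup {u v : List P} {k : ℕ} (h : weight wt u + weight wt v = k) :
    b u ⊗ₜ[ℂ] b v ∈ ⨆ p ∈ Finset.HasAntidiagonal.antidiagonal k,
      LinearMap.range (TensorProduct.map (wordGrade b wt p.1).subtype
        (wordGrade b wt p.2).subtype) := by
  refine Submodule.mem_iSup_of_mem (weight wt u, weight wt v)
    (Submodule.mem_iSup_of_mem (by simpa using h) ?_)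
  exact ⟨⟨b u, basis_mem_wordGrade b wt u⟩ ⊗ₜ ⟨b v, basis_mem_wordGrade b wt v⟩, by simp⟩

theorem counit_eq_zero_of_mem_wordGrade (k : ℕ) (x : M) (hk : k ≠ 0) (hx : x ∈ wordGrade b wt k) :
    wordCounit b x = 0 := by
  classical
  refine (Submodule.mem_bot ℂ).1 (map_mem_of_basis b wt (wordCounit b) (fun w hw => ?_) hx)
  rw [Submodule.mem_bot, wordCounit_basis, if_neg]
  rintro rfl
  exact hk hw.symm

theorem antipode_mem_wordGrade (k : ℕ) (x : M) (hx : x ∈ wordGrade b wt k) :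
    wordAntipode b x ∈ wordGrade b wt k := by
  refine map_mem_of_basis b wt (wordAntipode b) (fun w hw => ?_) hx
  rw [wordAntipode_basis]
  refine Submodule.smul_mem _ _ (basis_mem_wordGrade' b wt ?_)
  rw [← hw, weight, weight, List.map_reverse, List.sum_reverse]

theorem weight_of_mem_shuffles (u v w : List P) (h : w ∈ shuffles u v) :
    weight wt w = weight wt u + weight wt v := by
  induction w generalizing u v with
  | nil =>
    cases u with
    | nil => cases v <;> simp_all [shuffles_nil_left, weight]
    | cons a u => cases v <;> simp_all [shuffles_nil_right, shuffles_cons_cons]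
  | cons d w ih =>
    cases u with
    | nil => simp_all [shuffles_nil_left, weight]
    | cons a u =>
      cases v with
      | nil => simp_all [shuffles_nil_right, weight]
      | cons c v =>
        rw [shuffles_cons_cons] at h
        simp only [List.mem_append, List.mem_map, List.cons.injEq] at h
        rcases h with ⟨l, hl, rfl, rfl⟩ | ⟨l, hl, rfl, rfl⟩
        · have := ih _ _ hl
          simp only [weight, List.map_cons, List.sum_cons] at this ⊢
          omega
        · have := ih _ _ hl
          simp only [weight, List.map_cons, List.sum_cons] at this ⊢
          omega

/-- The weight of a subword is the sum of letter weights over its positions, and complementary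
position sets exhaust the word. -/
theorem weight_subword (w : List P) (I : Finset (Fin w.length)) :
    weight wt (subword w I) + weight wt (subword w Iᶜ) = weight wt w := by
  have h : ∀ J : Finset (Fin w.length), weight wt (subword w J) = ∑ i ∈ J, wt (w.get i) := by
    intro J
    have hl : ∀ l : List (Fin w.length), (((l.filter (· ∈ J)).map w.get).map wt).sum =
        (l.map fun i => if i ∈ J then wt (w.get i) else 0).sum := by
      intro l
      induction l with
      | nil => rfl
      | cons i l ih => by_cases hi : i ∈ J <;> simp_all
    rw [weight, subword, hl, ← Fin.sum_univ_def, Finset.sum_ite_mem, Finset.univ_inter]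
  rw [h, h, Finset.sum_add_sum_compl]
  simp [weight, ← Fin.sum_univ_fun_getElem]

theorem shuffleOps_isGradedConnected (hwt : ∀ p, wt p ≠ 0) :
    (shuffleOps b).IsGradedConnected (wordGrade b wt) where
  isInternal := wordGrade_isInternal b wt
  mul_mem := mul_mem_wordGrade b wt fun u v => by
    rw [shuffleOps, shuffleMul_basis]
    refine list_sum_mem fun x hx => ?_
    obtain ⟨w, hw, rfl⟩ := List.mem_map.1 hx
    exact basis_mem_wordGrade' b wt (weight_of_mem_shuffles wt u v w hw)
  gr_zero := wordGrade_zero b wt hwt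
  comul_mem k x hx := by
    refine map_mem_of_basis b wt (deconcat b) (fun w hw => ?_) hx
    simp only [deconcat, Module.Basis.constr_basis]
    refine Submodule.sum_mem _ fun i _ => tmul_mem_iSup b wt ?_
    rw [← weight_append, List.take_append_drop, hw]
  counit_eq_zero := counit_eq_zero_of_mem_wordGrade b wt
  antipode_mem := antipode_mem_wordGrade b wt

theorem concatOps_isGradedConnected (hwt : ∀ p, wt p ≠ 0) :
    (concatOps b).IsGradedConnected (wordGrade b wt) where
  isInternal := wordGrade_isInternal b wt
  mul_mem := mul_mem_wordGrade b wt fun u v => by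
    rw [concatOps, concatMul_basis]
    exact basis_mem_wordGrade' b wt (weight_append wt u v)
  gr_zero := wordGrade_zero b wt hwt
  comul_mem k x hx := by
    refine map_mem_of_basis b wt (deshuffle b) (fun w hw => ?_) hx
    simp only [deshuffle, Module.Basis.constr_basis]
    refine Submodule.sum_mem _ fun I _ => tmul_mem_iSup b wt ?_
    rw [← hw, ← weight_subword wt w I]
  counit_eq_zero := counit_eq_zero_of_mem_wordGrade b wt
  antipode_mem := antipode_mem_wordGrade b wt

theorem wordPairing_orthogonal (i j : ℕ) (x y : M) (hij : i ≠ j) (hx : x ∈ wordGrade b wt i)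
    (hy : y ∈ wordGrade b wt j) : wordPairing b x y = 0 := by
  refine (Submodule.mem_bot ℂ).1 (map_mem_of_basis b wt (wordPairing b x) (fun w hw => ?_) hy)
  rw [Submodule.mem_bot, wordPairing_basis_right]
  by_contra h
  exact hij (((mem_wordGrade_iff b wt).1 hx w h).symm.trans hw)

/-- A nonzero coordinate of an element of degree `k` sits at a word of weight `k`, which is
available as a test vector; this gives injectivity, and equality of dimensions with the dual gives
the rest. -/
theorem wordPairing_perfect (k : ℕ) [Module.Finite ℂ (wordGrade b wt k)] :
    Function.Bijective
      ((wordPairing b).domRestrict₁₂ (wordGrade b wt k) (wordGrade b wt k)) := by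
  have hinj : Function.Injective
      ((wordPairing b).domRestrict₁₂ (wordGrade b wt k) (wordGrade b wt k)) := by
    rw [injective_iff_map_eq_zero]
    rintro ⟨x, hx⟩ h
    refine Subtype.ext (b.ext_elem fun w => ?_)
    by_contra hw
    have hw' : b.repr x w ≠ 0 := by simpa using hw
    have := LinearMap.congr_fun h
      ⟨b w, basis_mem_wordGrade' b wt ((mem_wordGrade_iff b wt).1 hx w hw')⟩
    exact hw' ((wordPairing_basis_right b x w).symm.trans this)
  exact ⟨hinj, (LinearMap.injective_iff_surjective_of_finrank_eq_finrank
    (Subspace.dual_finrank_eq).symm).1 hinj⟩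

theorem areGradedDual (hfin : ∀ k, Module.Finite ℂ (wordGrade b wt k)) :
    AreGradedDual (wordGrade b wt) (wordPairing b) (shuffleOps b) (concatOps b) where
  finite := hfin
  perfect_left k := wordPairing_perfect b wt k
  perfect_right k := by
    have : ((wordPairing b).domRestrict₁₂ (wordGrade b wt k) (wordGrade b wt k)).flip =
        (wordPairing b).domRestrict₁₂ (wordGrade b wt k) (wordGrade b wt k) :=
      LinearMap.ext₂ fun x y => wordPairing_comm b y x
    rw [this]
    exact wordPairing_perfect b wt k
  orthogonal := wordPairing_orthogonal b wt
  mul_left := wordPairing_shuffleMul b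
  mul_right := wordPairing_concatMul b
  one_left := wordPairing_empty b
  one_right x := (wordPairing_comm b _ _).trans (wordPairing_empty b x)
  antipode := wordPairing_antipode b

/-- For every basis of words and positive weights of the letters, the two sets of operations are
graded connected Hopf algebras, dual to each other. -/
theorem wordOps_hopf_graded_dual {M : Type u} [AddCommMonoid M] [Module ℂ M]
    (b : Module.Basis (List P) ℂ M) {gr : ℕ → Submodule ℂ M} (hwt : ∀ p, wt p ≠ 0)
    (hgr : ∀ k, gr k = Submodule.span ℂ (b '' {w | weight wt w = k}))
    (hfin : ∀ k, {w | weight wt w = k}.Finite) :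
    (shuffleOps b).IsHopfAlgebra ∧ (shuffleOps b).IsGradedConnected gr ∧
      (concatOps b).IsHopfAlgebra ∧ (concatOps b).IsGradedConnected gr ∧
      AreGradedDual gr (wordPairing b) (shuffleOps b) (concatOps b) := by
  -- Negation comes from the scalar -1, so the given additive monoid structure is kept.
  let group : AddCommGroup M := Module.addCommMonoidToAddCommGroup ℂ
  obtain rfl : gr = wordGrade b wt := funext hgr
  exact ⟨(shuffleOps_axioms b).isHopfAlgebra, shuffleOps_isGradedConnected b wt hwt,
    (concatOps_axioms b).isHopfAlgebra, concatOps_isGradedConnected b wt hwt,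
    areGradedDual b wt fun k => Module.Finite.span_of_finite ℂ ((hfin k).image b)⟩

end Grading

/-! ### Words in Fourier space and the coordinate description of T(X). -/

section WordBasis

variable {A : Type u} (f : Module.Basis A ℂ (V A))

/-- The basis of `V^{⊗ k}` formed by the words of length `k`. -/
noncomputable def powerBasis (k : ℕ) : Module.Basis (Fin k → A) ℂ (⨂[ℂ]^k (V A)) :=
  Basis.piTensorProduct fun _ : Fin k => f

theorem powerBasis_apply {k : ℕ} (g : Fin k → A) :
    powerBasis f k g = PiTensorProduct.tprod ℂ fun i => f (g i) :=
  Basis.piTensorProduct_apply _ _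

theorem dfinsuppBasis_apply {ι : Type*} [DecidableEq ι] {M : ι → Type*}
    [∀ i, AddCommMonoid (M i)] [∀ i, Module ℂ (M i)] {η : ι → Type*}
    (b : ∀ i, Module.Basis (η i) ℂ (M i)) (s : Σ i, η i) :
    DFinsupp.basis b s = DFinsupp.single s.1 (b s.1 s.2) := by
  rw [Module.Basis.apply_eq_iff]
  refine (LinearEquiv.symm_apply_eq (sigmaFinsuppLequivDFinsupp ℂ)).2 ?_
  simp

/-- The basis of `T(V)` formed by the tensors of words. -/
noncomputable def wordBasis : Module.Basis (List A) ℂ (TV A) :=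
  (DFinsupp.basis (powerBasis f)).reindex List.equivSigmaTuple.symm

theorem wordBasis_repr (x : TV A) (w : List A) :
    (wordBasis f).repr x w = (powerBasis f w.length).repr (x w.length) w.get := by
  simp [wordBasis]
  rfl

theorem wordBasis_apply (w : List A) : wordBasis f w = wordTensor f w := by
  rw [wordBasis, Module.Basis.reindex_apply]
  refine (dfinsuppBasis_apply _ _).trans ?_
  rw [powerBasis_apply]
  rfl

/-- In `TensorAlgebra` a word is a product of generators, so multiplicativity is immediate there;
this avoids identifying tensor powers whose orders are only propositionally equal. -/
theorem wordTensor_append (u v : List A) :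
    wordTensor f (u ++ v) = wordTensor f u * wordTensor f v := by
  have h : ∀ w, wordTensor f w =
      TensorAlgebra.toDirectSum (w.map fun a => TensorAlgebra.ι ℂ (f a)).prod := by
    intro w
    rw [← TensorAlgebra.toDirectSum_ofDirectSum (wordTensor f w), wordTensor]
    congr 1
    refine (TensorAlgebra.ofDirectSum_of_tprod _).trans ?_
    rw [TensorAlgebra.tprod_apply]
    congr 1
    exact List.ext_get (by simp) fun _ _ _ => by simp
  rw [h, h, h, List.map_append, List.prod_append, map_mul]

variable {f} [Fintype A] {o : A}

section Form
variable (hf : Pairwise fun a c => inner ℂ (f a) (f c) = 0)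
    (ho : ∃ c : ℂ, f o = c • dBvec A)
include hf ho

theorem letterForm_of_ne {a : A} (ha : a ≠ o) : letterForm A (f a) = 0 := by
  obtain ⟨c, hc⟩ := ho
  have hc0 : c ≠ 0 := by
    rintro rfl
    exact f.ne_zero o (by simpa using hc)
  have h := hf ha.symm
  simp only [hc, inner_smul_left] at h
  exact (mul_eq_zero.1 h).resolve_left (by simpa using hc0)

omit hf in
theorem letterForm_self_ne_zero : letterForm A (f o) ≠ 0 := by
  obtain ⟨c, hc⟩ := ho
  intro h
  refine f.ne_zero o (f.ext_elem fun _ => ?_)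
  have : inner ℂ (f o) (f o) = (0 : ℂ) := by
    conv_lhs => rw [hc, inner_smul_left, ← hc]
    exact mul_eq_zero_of_right _ h
  rw [inner_self_eq_zero.1 this]

/-- A basis word contributes to the coordinate at `h` only if it is `h` preceded by `o`, since the
form kills every other first letter. -/
theorem thetaL_repr {k : ℕ} (x : ⨂[ℂ]^(k + 1) (V A)) (h : Fin k → A) :
    (powerBasis f k).repr (thetaL A (k + 1) x) h =
      letterForm A (f o) * (powerBasis f (k + 1)).repr x (Fin.cons o h) := by
  classical
  have : (powerBasis f k).coord h ∘ₗ thetaL A (k + 1) =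
      letterForm A (f o) • (powerBasis f (k + 1)).coord (Fin.cons o h) :=
    (powerBasis f (k + 1)).ext fun g => by
      have hθ : thetaL A (k + 1) (powerBasis f (k + 1) g) =
          letterForm A (f (g 0)) • powerBasis f k (Fin.tail g) := by
        rw [powerBasis_apply, powerBasis_apply]
        exact PiTensorProduct.lift.tprod _
      rw [LinearMap.comp_apply, hθ, map_smul, LinearMap.smul_apply, Module.Basis.coord_apply,
        Module.Basis.coord_apply, Module.Basis.repr_self, Module.Basis.repr_self,
        Finsupp.single_apply, Finsupp.single_apply]
      by_cases hg : g 0 = o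
      · have : Fin.tail g = h ↔ g = Fin.cons o h := by
          constructor
          · rintro rfl
            rw [← hg, Fin.cons_self_tail]
          · rintro rfl
            simp
        simp [hg, this]
      · have : g ≠ Fin.cons o h := by
          rintro rfl
          exact hg rfl
        simp [this, letterForm_of_ne hf ho hg]
  exact LinearMap.congr_fun this x

theorem thetaR_repr {k : ℕ} (x : ⨂[ℂ]^(k + 1) (V A)) (h : Fin k → A) :
    (powerBasis f k).repr (thetaR A (k + 1) x) h =
      letterForm A (f o) * (powerBasis f (k + 1)).repr x (Fin.snoc h o) := by
  classical
  have : (powerBasis f k).coord h ∘ₗ thetaR A (k + 1) =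
      letterForm A (f o) • (powerBasis f (k + 1)).coord (Fin.snoc h o) :=
    (powerBasis f (k + 1)).ext fun g => by
      have hθ : thetaR A (k + 1) (powerBasis f (k + 1) g) =
          letterForm A (f (g (Fin.last k))) • powerBasis f k (Fin.init g) := by
        rw [powerBasis_apply, powerBasis_apply]
        exact PiTensorProduct.lift.tprod _
      rw [LinearMap.comp_apply, hθ, map_smul, LinearMap.smul_apply, Module.Basis.coord_apply,
        Module.Basis.coord_apply, Module.Basis.repr_self, Module.Basis.repr_self,
        Finsupp.single_apply, Finsupp.single_apply]
      by_cases hg : g (Fin.last k) = o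
      · have : Fin.init g = h ↔ g = Fin.snoc h o := by
          constructor
          · rintro rfl
            rw [← hg, Fin.snoc_init_self]
          · rintro rfl
            simp
        simp [hg, this]
      · have : g ≠ Fin.snoc h o := by
          rintro rfl
          exact hg (by simp)
        simp [this, letterForm_of_ne hf ho hg]
  exact LinearMap.congr_fun this x

theorem mem_ker_thetaL {k : ℕ} {x : ⨂[ℂ]^(k + 1) (V A)} :
    thetaL A (k + 1) x = 0 ↔ ∀ g, (powerBasis f (k + 1)).repr x g ≠ 0 → g 0 ≠ o := by
  constructor
  · rintro hx g hg rfl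
    have := thetaL_repr hf ho x (Fin.tail g)
    rw [hx, map_zero, Fin.cons_self_tail] at this
    exact mul_ne_zero (letterForm_self_ne_zero ho) hg this.symm
  · intro h
    refine (powerBasis f k).ext_elem fun g => ?_
    rw [thetaL_repr hf ho, map_zero]
    by_contra hg
    exact h _ (right_ne_zero_of_mul hg) rfl

theorem mem_ker_thetaR {k : ℕ} {x : ⨂[ℂ]^(k + 1) (V A)} :
    thetaR A (k + 1) x = 0 ↔ ∀ g, (powerBasis f (k + 1)).repr x g ≠ 0 → g (Fin.last k) ≠ o := by
  constructor
  · rintro hx g hg rfl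
    have := thetaR_repr hf ho x (Fin.init g)
    rw [hx, map_zero, Fin.snoc_init_self] at this
    exact mul_ne_zero (letterForm_self_ne_zero ho) hg this.symm
  · intro h
    refine (powerBasis f k).ext_elem fun g => ?_
    rw [thetaR_repr hf ho, map_zero]
    by_contra hg
    exact h _ (right_ne_zero_of_mul hg) (by simp)

end Form

/-- Neither the first nor the last letter of `w` is `o`. -/
def EndsAvoid (o : A) (w : List A) : Prop := w.head? ≠ some o ∧ w.getLast? ≠ some o

variable (hf : Pairwise fun a c => inner ℂ (f a) (f c) = 0)
    (ho : ∃ c : ℂ, f o = c • dBvec A)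
include hf ho

theorem mem_X_iff {k : ℕ} {x : ⨂[ℂ]^k (V A)} :
    x ∈ X A k ↔ ∀ g, (powerBasis f k).repr x g ≠ 0 → EndsAvoid o (List.ofFn g) := by
  cases k with
  -- In order 0 both operators vanish, and the empty word has no end letters to avoid.
  | zero => simp [X, thetaL, thetaR, EndsAvoid]
  | succ k =>
    rw [X, Submodule.mem_inf, LinearMap.mem_ker, LinearMap.mem_ker, mem_ker_thetaL hf ho,
      mem_ker_thetaR hf ho, ← forall₂_and]
    refine forall₂_congr fun g _ => ?_
    rw [EndsAvoid, List.getLast?_eq_some_getLast (by simp), List.getLast_ofFn_succ]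
    simp

theorem mem_TX_iff {x : TV A} :
    x ∈ TX A ↔ ∀ w, (wordBasis f).repr x w ≠ 0 → EndsAvoid o w := by
  simp only [wordBasis_repr]
  constructor
  · intro h w hw
    have := (mem_X_iff hf ho).1 (h w.length) w.get hw
    rwa [List.ofFn_get] at this
  · intro h k
    refine (mem_X_iff hf ho).2 fun g hg => h _ ?_
    -- Coordinates depend on the order of the tensor, so they are compared along an equality of
    -- pairs (order, tuple).
    have key : ∀ s t : Σ n, Fin n → A, s = t →
        (powerBasis f s.1).repr (x s.1) s.2 = (powerBasis f t.1).repr (x t.1) t.2 := by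
      rintro s _ rfl
      rfl
    exact (key _ _ (List.equivSigmaTuple.apply_symm_apply ⟨k, g⟩)).trans_ne hg

theorem TX_eq_span : TX A = Submodule.span ℂ (wordBasis f '' {w | EndsAvoid o w}) := by
  ext x
  rw [Module.Basis.mem_span_image, mem_TX_iff hf ho]
  simp [Set.subset_def]

theorem wordTensor_mem_TX {w : List A} : wordTensor f w ∈ TX A ↔ EndsAvoid o w := by
  classical
  rw [← wordBasis_apply, mem_TX_iff hf ho]
  simp [Finsupp.single_apply]

end WordBasis

/-! ### Unique factorization of words avoiding `o` at both ends. -/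

section FreeMonoid

variable {A : Type u} {o : A}

theorem EndsAvoid.append {u v : List A} (hu : EndsAvoid o u) (hv : EndsAvoid o v) :
    EndsAvoid o (u ++ v) := by
  cases u with
  | nil => simpa using hv
  | cons a u =>
    refine ⟨by simpa using hu.1, ?_⟩
    rw [List.getLast?_append]
    cases h : v.getLast? with
    | none => simpa using hu.2
    | some c => simpa [h] using hv.2

/-- A nonempty word that avoids `o` at both ends and is not the concatenation of two such words. -/
def IsIndecomposable (o : A) (w : List A) : Prop :=
  w ≠ [] ∧ EndsAvoid o w ∧ ∀ u v : List A, u ≠ [] → v ≠ [] → w = u ++ v →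
    ¬ (EndsAvoid o u ∧ EndsAvoid o v)

theorem endsAvoid_flatten {l : List (List A)} (hl : ∀ p ∈ l, EndsAvoid o p) :
    EndsAvoid o l.flatten := by
  induction l with
  | nil => simp [EndsAvoid]
  | cons p l ih =>
    rw [List.flatten_cons]
    exact (hl p (by simp)).append (ih fun q hq => hl q (by simp [hq]))

/-- Strong induction on length: a nonempty word that is not indecomposable splits into two shorter
words of the same kind. -/
theorem exists_flatten_eq {w : List A} (hw : EndsAvoid o w) :
    ∃ l : List (List A), (∀ p ∈ l, IsIndecomposable o p) ∧ l.flatten = w := by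
  induction h : w.length using Nat.strong_induction_on generalizing w with
  | _ n ih =>
    subst h
    by_cases h0 : w = []
    · exact ⟨[], by simp, by simp [h0]⟩
    by_cases hi : IsIndecomposable o w
    · exact ⟨[w], by simpa using hi, by simp⟩
    · have : ∃ u v : List A, u ≠ [] ∧ v ≠ [] ∧ w = u ++ v ∧ EndsAvoid o u ∧ EndsAvoid o v := by
        by_contra hcon
        push Not at hcon
        exact hi ⟨h0, hw, fun u v hu hv he h => hcon u v hu hv he h.1 h.2⟩
      obtain ⟨u, v, hu, hv, rfl, hgu, hgv⟩ := this
      have hu' := List.length_pos_iff.2 hu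
      have hv' := List.length_pos_iff.2 hv
      have hlen : (u ++ v).length = u.length + v.length := List.length_append
      obtain ⟨l, hl, rfl⟩ := ih u.length (by omega) hgu rfl
      obtain ⟨m, hm, rfl⟩ := ih v.length (by omega) hgv rfl
      exact ⟨l ++ m, fun p hp => (List.mem_append.1 hp).elim (hl p) (hm p), by simp⟩

/-- If `p` were a proper prefix, `q = p ++ r` and `s = r ++ t`, then `r` would begin like `s` and
end like `q`. So `r` avoids `o` at both ends and `q` decomposes, a contradiction; the other case is
symmetric. -/
theorem IsIndecomposable.eq_of_append_eq {p q s t : List A} (hp : IsIndecomposable o p)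
    (hq : IsIndecomposable o q) (hs : EndsAvoid o s) (ht : EndsAvoid o t)
    (h : p ++ s = q ++ t) : p = q := by
  have key : ∀ {p q s t : List A}, IsIndecomposable o p → IsIndecomposable o q → EndsAvoid o s →
      (∃ r, q = p ++ r ∧ s = r ++ t) → p = q := by
    rintro p q s t hp hq hs ⟨r, rfl, rfl⟩
    by_contra hne
    have hr : r ≠ [] := by
      rintro rfl
      simp at hne
    refine hq.2.2 p r hp.1 hr rfl ⟨hp.2.1, ?_, ?_⟩
    · have := hs.1
      rwa [List.head?_append_of_ne_nil _ hr] at this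
    · have := hq.2.1.2
      rwa [List.getLast?_append_of_ne_nil _ hr] at this
  rcases List.append_eq_append_iff.1 h with ⟨r, h1, h2⟩ | ⟨r, h1, h2⟩
  · exact key hp hq hs ⟨r, h1, h2⟩
  · exact (key hq hp ht ⟨r, h1, h2⟩).symm

theorem flatten_injOn {l m : List (List A)} (hl : ∀ p ∈ l, IsIndecomposable o p)
    (hm : ∀ p ∈ m, IsIndecomposable o p) (h : l.flatten = m.flatten) : l = m := by
  induction l generalizing m with
  | nil =>
    cases m with
    | nil => rfl
    | cons q m =>
      exact absurd (List.append_eq_nil_iff.1 h.symm).1 (hm q (by simp)).1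
  | cons p l ih =>
    cases m with
    | nil => exact absurd (List.append_eq_nil_iff.1 h).1 (hl p (by simp)).1
    | cons q m =>
      rw [List.flatten_cons, List.flatten_cons] at h
      have hl' : ∀ p ∈ l, IsIndecomposable o p := fun r hr => hl r (by simp [hr])
      have hm' : ∀ p ∈ m, IsIndecomposable o p := fun r hr => hm r (by simp [hr])
      have hpq := (hl p (by simp)).eq_of_append_eq (hm q (by simp))
        (endsAvoid_flatten fun r hr => (hl' r hr).2.1)
        (endsAvoid_flatten fun r hr => (hm' r hr).2.1) h
      subst hpq
      rw [ih hl' hm' (List.append_cancel_left h)]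

end FreeMonoid

/-! ### The basis of T(X) by words over the primitive words, and its grading. -/

section TXBasis

variable {A : Type u} [Fintype A] {f : Module.Basis A ℂ (V A)} {o : A}
  (hf : Pairwise fun a c => inner ℂ (f a) (f c) = 0) (ho : ∃ c : ℂ, f o = c • dBvec A)
include hf ho

theorem isPrimitive_iff {w : List A} : IsPrimitive f w ↔ IsIndecomposable o w := by
  simp only [IsPrimitive, IsIndecomposable, wordTensor_mem_TX hf ho]

/-- The word in the letters of `A` spelled by a word in primitive words. -/
abbrev spell (f : Module.Basis A ℂ (V A)) (u : List (PrimitiveWord f)) : List A :=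
  (u.map Subtype.val).flatten

theorem spell_injective : Function.Injective (spell f) := fun u v h =>
  List.map_injective_iff.2 Subtype.val_injective <| flatten_injOn
    (fun p hp => by
      obtain ⟨q, -, rfl⟩ := List.mem_map.1 hp
      exact (isPrimitive_iff hf ho).1 q.2)
    (fun p hp => by
      obtain ⟨q, -, rfl⟩ := List.mem_map.1 hp
      exact (isPrimitive_iff hf ho).1 q.2) h

theorem range_spell : Set.range (spell f) = {w | EndsAvoid o w} := by
  ext w
  constructor
  · rintro ⟨u, rfl⟩
    refine endsAvoid_flatten fun p hp => ?_
    obtain ⟨q, -, rfl⟩ := List.mem_map.1 hp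
    exact ((isPrimitive_iff hf ho).1 q.2).2.1
  · intro hw
    obtain ⟨l, hl, rfl⟩ := exists_flatten_eq hw
    lift l to List (PrimitiveWord f) using fun p hp => (isPrimitive_iff hf ho).2 (hl p hp)
    exact ⟨l, rfl⟩

/-- Spelling is a bijection onto the words that span T(X), so this is a reindexed part of the word
basis of T(V). -/
theorem exists_TX_basis : ∃ b : Module.Basis (List (PrimitiveWord f)) ℂ (TX A),
    ∀ u, (b u : TV A) = wordTensor f (spell f u) := by
  have hli : LinearIndependent ℂ fun u : List (PrimitiveWord f) => wordBasis f (spell f u) :=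
    (wordBasis f).linearIndependent.comp _ (spell_injective hf ho)
  have hspan : Submodule.span ℂ (Set.range fun u : List (PrimitiveWord f) =>
      wordBasis f (spell f u)) = TX A := by
    rw [TX_eq_span hf ho, ← range_spell hf ho, ← Set.range_comp]
    rfl
  refine ⟨(Module.Basis.span hli).map (LinearEquiv.ofEq _ _ hspan), fun u => ?_⟩
  rw [← wordBasis_apply, Module.Basis.map_apply, LinearEquiv.coe_ofEq_apply,
    Module.Basis.span_apply]

omit hf ho in
theorem weight_length (u : List (PrimitiveWord f)) :
    weight (fun p : PrimitiveWord f => p.1.length) u = (spell f u).length := by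
  simp [weight, spell, List.length_flatten]

theorem gradeTX_eq_span {b : Module.Basis (List (PrimitiveWord f)) ℂ (TX A)}
    (hb : ∀ u, (b u : TV A) = wordTensor f (spell f u)) (k : ℕ) :
    gradeTX A k = Submodule.span ℂ
      (b '' {u | weight (fun p : PrimitiveWord f => p.1.length) u = k}) := by
  apply le_antisymm
  · rintro ⟨x, hx⟩ ⟨y, rfl⟩
    rw [Module.Basis.mem_span_image]
    intro u hu
    by_contra hk
    rw [Set.mem_ofPred_eq, weight_length] at hk
    refine Finsupp.mem_support_iff.1 hu ?_
    -- Coordinates in T(X) are coordinates in T(V) at the spelled word; for a homogeneous tensor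
    -- they vanish at words of another length.
    have key : (wordBasis f).coord (spell f u) ∘ₗ (TX A).subtype = b.coord u := b.ext fun v => by
      classical
      simp [hb, ← wordBasis_apply, Finsupp.single_apply, (spell_injective hf ho).eq_iff]
    have := LinearMap.congr_fun key ⟨_, hx⟩
    refine this.symm.trans ?_
    simp only [LinearMap.comp_apply, Submodule.subtype_apply, Module.Basis.coord_apply,
      wordBasis_repr]
    rw [DirectSum.lof_eq_of, DirectSum.of_eq_of_ne _ _ _ hk, map_zero]
    rfl
  · refine Submodule.span_le.2 ?_
    rintro _ ⟨u, hu, rfl⟩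
    rw [Set.mem_ofPred_eq, weight_length] at hu
    subst hu
    exact ⟨_, (hb u).symm⟩

/-- Spelling is injective, and a finite alphabet has finitely many words of length `k`. -/
theorem finite_weight_eq (k : ℕ) :
    {u | weight (fun p : PrimitiveWord f => p.1.length) u = k}.Finite := by
  refine ((List.finite_length_eq A k).preimage ((spell_injective hf ho).injOn)).subset ?_
  intro u hu
  rw [Set.mem_ofPred_eq, weight_length] at hu
  exact hu

end TXBasis

end DeBruijn

/-- `f` is an orthogonal (Fourier) basis of `V_A` one of whose members, `f o`, is the de Bruijn
vector up to a scalar. The words over the alphabet of primitive words form a basis of `T(X)`, and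
with respect to it `T(X)` is a graded connected Hopf algebra in two ways, dual to each other. -/
theorem mainTheorem3 (A : Type*) [Fintype A] [Nonempty A]
    (f : Module.Basis A ℂ (DeBruijn.V A)) (o : A)
    (hf : Pairwise fun a c => inner ℂ (f a) (f c) = 0)
    (ho : ∃ c : ℂ, f o = c • DeBruijn.dBvec A) :
    ∃ b : Module.Basis (List (DeBruijn.PrimitiveWord f)) ℂ (DeBruijn.TX A),
      (∀ u, (b u : DeBruijn.TV A) = DeBruijn.wordTensor f (u.map Subtype.val).flatten) ∧
      (∀ x y, (DeBruijn.concatMul b x y : DeBruijn.TV A) = (x : DeBruijn.TV A) * y) ∧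
      (DeBruijn.shuffleOps b).IsHopfAlgebra ∧
      (DeBruijn.shuffleOps b).IsGradedConnected (DeBruijn.gradeTX A) ∧
      (DeBruijn.concatOps b).IsHopfAlgebra ∧
      (DeBruijn.concatOps b).IsGradedConnected (DeBruijn.gradeTX A) ∧
      DeBruijn.AreGradedDual (DeBruijn.gradeTX A) (DeBruijn.wordPairing b)
        (DeBruijn.shuffleOps b) (DeBruijn.concatOps b) := by
  obtain ⟨b, hb⟩ := DeBruijn.exists_TX_basis hf ho
  have hlen : ∀ p : DeBruijn.PrimitiveWord f, p.1.length ≠ 0 := fun p h =>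
    p.2.1 (List.length_eq_zero_iff.1 h)
  refine ⟨b, hb, fun x y => ?_, DeBruijn.wordOps_hopf_graded_dual _ b hlen
    (DeBruijn.gradeTX_eq_span hf ho hb) (DeBruijn.finite_weight_eq hf ho)⟩
  -- Both products agree on basis words because spelling and `wordTensor` each turn concatenation
  -- into multiplication.
  have h : (DeBruijn.concatMul b).compr₂ (DeBruijn.TX A).subtype =
      (LinearMap.mul ℂ (DeBruijn.TV A)).compl₁₂ (DeBruijn.TX A).subtype (DeBruijn.TX A).subtype :=
    b.ext fun u => b.ext fun v => by
      change (DeBruijn.concatMul b (b u) (b v) : DeBruijn.TV A) = (b u : DeBruijn.TV A) * b v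
      rw [DeBruijn.concatMul_basis, hb, hb, hb, ← DeBruijn.wordTensor_append, DeBruijn.spell,
        List.map_append, List.flatten_append]
  exact LinearMap.congr_fun₂ h x y
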